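/- Consider the autonomous system $$\frac{dT}{d\bar\tau}=3T(1-T)^2\sin^2\theta,\qquad \frac{d\theta}{d\bar\tau}=-T-\tfrac32(1-T)\sin 2\theta$$ on the closed cylinder $\bar{\mathbf S}=[0,1]\times(\mathbb R/2\pi\mathbb Z)$ with coordinates $(T,\theta)$, let $\mathbf S=\{0<T<1\}$ be its interior, and let $q=-1+3\sin^2\theta$ be the deceleration parameter. Put $$\mathrm M_\pm=(0,\pm\tfrac{\pi}{2}),\qquad \mathrm{dS}_+=(0,0),\qquad \mathrm{dS}_-=(0,\pi).$$ The $\omega$-limit set (respectively $\alpha$-limit set) of a solution is the set of its accumulation points as $\bar\tau\to+\infty$ (respectively $\bar\tau\to-\infty$). Then the following hold. 1. Through every point of $\bar{\mathbf S}$ there passes exactly one solution in $\bar{\mathbf S}$ defined for all $\bar\tau\in\mathbb R$; the sets $\{T=0\}$, $\mathbf S$ and $\{T=1\}$ are invariant. The map $\theta\mapsto\theta+\pi$ takes solutions to solutions, $\mathrm M_+$ to $\mathrm M_-$ and $\mathrm{dS}_+$ to $\mathrm{dS}_-$. 2. Along every solution in $\mathbf S$, $T$ is strictly increasing in $\bar\tau$.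 3. The fixed points in $\bar{\mathbf S}$ are exactly $\mathrm M_+,\mathrm M_-,\mathrm{dS}_+,\mathrm{dS}_-$. 4. $\mathrm M_\pm$ are hyperbolic sources: the linearization at each has eigenvalues $3,3$, and each is asymptotically stable in $\bar{\mathbf S}$ as $\bar\tau\to-\infty$. 5. $\mathrm{dS}_\pm$ are non-hyperbolic saddles: the linearization at each has eigenvalues $-3$ and $0$, with $-3$ belonging to the direction tangent to $T=0$. A solution in $\bar{\mathbf S}$ has $\omega$-limit set $\{\mathrm{dS}_+\}$ (respectively $\{\mathrm{dS}_-\}$) if and only if it lies on $T=0$ with $\cos\theta>0$ (respectively $\cos\theta<0$) at $\bar\tau=0$. A solution on $T=0$ with $\sin\theta>0$ (respectively $\sin\theta<0$) at $\bar\tau=0$ has $\alpha$-limit set $\{\mathrm M_+\}$ (respectively $\{\mathrm M_-\}$). 6. There is exactly one orbit in $\mathbf S$ with $\alpha$-limit set $\{\mathrm{dS}_+\}$ and exactly one orbit in $\mathbf S$ with $\alpha$-limit set $\{\mathrm{dS}_-\}$ (the attractor solutions); the second is the image of the first under $\theta\mapsto\theta+\pi$. Every other orbit in $\mathbf S$ has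 $\alpha$-limit set $\{\mathrm M_+\}$ or $\{\mathrm M_-\}$. 7. The circle $T=1$ is a periodic orbit, on which $d\theta/d\bar\tau=-1$, and it is the $\omega$-limit set of every orbit in $\mathbf S$. 8. Along every solution in $\mathbf S$ one has $-1\le q\le 2$, each of the values $q=-1$ and $q=2$ is attained at arbitrarily late times, and $q$ has no limit as $\bar\tau\to+\infty$ (asymptotic self-similarity is broken). -/

import Mathlib

open Filter Topology Set

namespace ScalarFieldFLRW

noncomputable section

/-- The infinite cylinder `ℝ × (ℝ / 2πℤ)` with coordinates `(T, θ)`. -/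
abbrev Cyl : Type := ℝ × Real.Angle

/-- The closed finite cylinder `0 ≤ T ≤ 1` (the extended state space). -/
def closedState : Set Cyl := {p | 0 ≤ p.1 ∧ p.1 ≤ 1}

/-- The physical state space `0 < T < 1`. -/
def state : Set Cyl := {p | 0 < p.1 ∧ p.1 < 1}

/-- The boundary circle `T = 0`. -/
def bottom : Set Cyl := {p | p.1 = 0}

/-- The boundary circle `T = 1`. -/
def top : Set Cyl := {p | p.1 = 1}

/-- The right-hand side of the system
`dT/dτ = 3 T (1 - T)² sin² θ`, `dθ/dτ = - T - (3/2) (1 - T) sin 2θ`,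
as the pair of its components in the coordinates `(T, θ)`. -/
def field (p : Cyl) : ℝ × ℝ :=
  (3 * p.1 * (1 - p.1) ^ 2 * p.2.sin ^ 2,
    -p.1 - 3 / 2 * (1 - p.1) * ((2 : ℕ) • p.2).sin)

/-- `c` is a solution in the closed cylinder, defined for all times. The derivative is computed in
a lift `(T, θ) : ℝ → ℝ × ℝ` of `c` (every continuous curve in the cylinder has one). -/
def IsSolution (c : ℝ → Cyl) : Prop :=
  (∀ τ, c τ ∈ closedState) ∧
  ∃ T θ : ℝ → ℝ, (∀ τ, c τ = (T τ, (θ τ : Real.Angle))) ∧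
    ∀ τ, HasDerivAt T (field (c τ)).1 τ ∧ HasDerivAt θ (field (c τ)).2 τ

/-- The set of accumulation points of a curve as `τ → +∞`. -/
def omegaSet (c : ℝ → Cyl) : Set Cyl := {p | MapClusterPt p atTop c}

/-- The set of accumulation points of a curve as `τ → -∞`. -/
def alphaSet (c : ℝ → Cyl) : Set Cyl := {p | MapClusterPt p atBot c}

/-- `O` is a periodic orbit: the range of a non-constant periodic solution. -/
def IsPeriodicOrbit (O : Set Cyl) : Prop :=
  ∃ c, IsSolution c ∧ range c = O ∧ O.Nontrivial ∧ ∃ P > 0, Function.Periodic c P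

/-- `O` is an orbit in the physical state space that originates from the point `p`. -/
def OriginatesFrom (p : Cyl) (O : Set Cyl) : Prop :=
  O ⊆ state ∧ ∃ c, IsSolution c ∧ range c = O ∧ alphaSet c = {p}

/-- Fixed points of the system on the closed cylinder. -/
def IsFixedPoint (p : Cyl) : Prop := p ∈ closedState ∧ field p = 0

/-- The linearization of the system at `p`, in the coordinates `(T, θ)` centred at `p`. -/
def linearization (p : Cyl) : (ℝ × ℝ) →L[ℝ] (ℝ × ℝ) :=
  fderiv ℝ (fun x : ℝ × ℝ => field (p.1 + x.1, p.2 + (x.2 : Real.Angle))) 0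

/-- The complex eigenvalues of the linearization at `p`, with algebraic multiplicity. -/
def eigenvalues (p : Cyl) : Multiset ℂ :=
  (linearization p : (ℝ × ℝ) →ₗ[ℝ] (ℝ × ℝ)).charpoly.aroots ℂ

/-- A fixed point is hyperbolic if no eigenvalue of the linearization lies on the imaginary axis. -/
def IsHyperbolic (p : Cyl) : Prop := IsFixedPoint p ∧ ∀ z ∈ eigenvalues p, z.re ≠ 0

/-- `p` is a source in the closed cylinder: it is asymptotically stable as `τ → -∞`. -/
def IsSource (p : Cyl) : Prop :=
  IsFixedPoint p ∧ ∀ V ∈ 𝓝 p, ∃ U ∈ 𝓝 p, ∀ c, IsSolution c → c 0 ∈ U →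
    (∀ τ ≤ 0, c τ ∈ V) ∧ Tendsto c atBot (𝓝 p)

/-- The massless scalar field point at `θ = π / 2`. -/
def MPlus : Cyl := (0, ((Real.pi / 2 : ℝ) : Real.Angle))

/-- The massless scalar field point at `θ = - π / 2`. -/
def MMinus : Cyl := (0, ((-Real.pi / 2 : ℝ) : Real.Angle))

/-- The de Sitter point at `θ = 0`. -/
def dSPlus : Cyl := (0, ((0 : ℝ) : Real.Angle))

/-- The de Sitter point at `θ = π`. -/
def dSMinus : Cyl := (0, (Real.pi : Real.Angle))

/-- The discrete symmetry `θ ↦ θ + π`. -/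
def halfTurn (p : Cyl) : Cyl := (p.1, p.2 + (Real.pi : Real.Angle))

/-- The deceleration parameter `q = -1 + 3 sin² θ`. -/
def decel (p : Cyl) : ℝ := -1 + 3 * p.2.sin ^ 2

end

end ScalarFieldFLRW

open ScalarFieldFLRW

/-! Freezing the field outside `0 ≤ T ≤ 1` makes it bounded and Lipschitz, so solutions are global
and unique, and uniqueness keeps `T = 0` and `T = 1` invariant. In the interior `T` increases, and
it cannot stay in a compact part of `(0, 1)`: there `sin θ cos θ - C T` is bounded but decreases at
a uniform rate. Hence `T → 0` in the past and `T → 1` in the future. Near `T = 1` the angle falls at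
a rate bounded away from zero, so every angle recurs; this gives the ω-limit circle and the
oscillation of `q`.

The past is governed by `u = T / (1 - T)` and the barrier `b = sin θ - u / 3`, for which `b' ≤ -3 (1
- T) cos² θ b` (`IsLift.hasDerivAt_barrier`, `IsLift.deriv_barrier_le`). Once positive, `b` does not
decrease into the past, and `sin θ → 1`: the orbit comes from `MPlus`. By the half-turn, `-sin θ > u
/ 3` at some time leads to `MMinus`. If neither ever happens, `|sin θ| ≤ u / 3` and the orbit comes
from a de Sitter point. The same barrier gives stability of the sources.

An orbit of the last kind exists by shooting (`exists_lift_tendsto_dSPlus`): on an arc of `T = 1/2`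
the initial angles leading to the two sources form disjoint nonempty open sets, which cannot cover
the arc. It is unique because, with `(y, p) = (cos θ, sin θ) / u`, such an orbit is near the de
Sitter point a graph `p = P y` with `-1/3 ≤ p < 0`, solving a scalar equation whose right side
increases with `p`. Two such graphs would separate without bound as `y → ∞` (`graph_unique`). -/

namespace ScalarFieldFLRW

/-! ### Global flow of a bounded Lipschitz field. -/

section GlobalFlow

open scoped NNReal

variable {E : Type*} [NormedAddCommGroup E] [NormedSpace ℝ E]

/-- A bounded and globally Lipschitz autonomous vector field has global integral curves. -/
theorem exists_global_integralCurve [CompleteSpace E] {v : E → E} {K M : ℝ≥0}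
    (hv : LipschitzWith K v) (hM : ∀ x, ‖v x‖ ≤ M) (x : E) :
    ∃ γ : ℝ → E, γ 0 = x ∧ ∀ t, HasDerivAt γ (v (γ t)) t := by
  have loc : ∀ n : ℕ, ∃ γ : ℝ → E, γ 0 = x ∧
      ∀ t ∈ Ioo (-(n + 1 : ℝ)) (n + 1), HasDerivAt γ (v (γ t)) t := by
    intro n
    have hn : (0 : ℝ) ≤ n := Nat.cast_nonneg n
    have h0 : (0 : ℝ) ∈ Icc (-(n + 1 : ℝ)) (n + 1) := ⟨by linarith, by linarith⟩
    -- As `v` is bounded by `M` everywhere, a ball of radius `M (n + 1)` suffices for time `n + 1`,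
    -- so the interval never has to shrink.
    have hpl : IsPicardLindelof (fun _ => v) (⟨0, h0⟩ : Icc (-(n + 1 : ℝ)) (n + 1)) x
        (M * (n + 1)) 0 M K :=
      { lipschitzOnWith := fun _ _ => hv.lipschitzOnWith
        continuousOn := fun _ _ => continuousOn_const
        norm_le := fun _ _ y _ => hM y
        mul_max_le := by simp }
    obtain ⟨γ, h1, h2⟩ := hpl.exists_eq_forall_mem_Icc_hasDerivWithinAt₀
    exact ⟨γ, h1, fun t ht => (h2 t (Ioo_subset_Icc_self ht)).hasDerivAt (Icc_mem_nhds ht.1 ht.2)⟩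
  choose γ h0 hγ using loc
  have agree : ∀ m n : ℕ, m ≤ n → ∀ t ∈ Ioo (-(m + 1 : ℝ)) (m + 1), γ m t = γ n t := by
    intro m n hmn t ht
    have hmn' : (m : ℝ) ≤ n := Nat.cast_le.2 hmn
    have hm : (0 : ℝ) ≤ m := Nat.cast_nonneg m
    exact ODE_solution_unique_of_mem_Ioo (v := fun _ => v) (s := fun _ => univ) (K := K) (t₀ := 0)
      (fun _ _ => hv.lipschitzOnWith) ⟨by linarith, by linarith⟩
      (fun s hs => ⟨hγ m s hs, mem_univ _⟩)
      (fun s hs => ⟨hγ n s ⟨by linarith [hs.1], by linarith [hs.2]⟩, mem_univ _⟩)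
      (by rw [h0, h0]) ht
  -- The local solutions agree on overlaps and are glued: index `⌈|t|⌉₊` suffices at `t`, since the
  -- `n`-th one lives on `|t| < n + 1`. One index more covers a neighbourhood of `t`.
  refine ⟨fun t => γ ⌈|t|⌉₊ t, by simp [h0], fun t => ?_⟩
  set N := ⌈|t|⌉₊ + 1 with hN
  have ht : |t| < (N : ℝ) := by
    have := Nat.le_ceil |t|
    push_cast [hN]
    linarith
  have hev : (fun s => γ ⌈|s|⌉₊ s) =ᶠ[𝓝 t] γ N := by
    have hopen : {s : ℝ | |s| < N} ∈ 𝓝 t := (isOpen_lt continuous_abs continuous_const).mem_nhds ht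
    filter_upwards [hopen] with s hs
    refine agree _ _ (Nat.ceil_le.2 (le_of_lt hs)) s ?_
    have := Nat.le_ceil |s|
    exact abs_lt.1 (by linarith)
  have hval : γ ⌈|t|⌉₊ t = γ N t := hev.eq_of_nhds
  have hd := hγ N t (abs_lt.1 (by linarith))
  show HasDerivAt (fun s => γ ⌈|s|⌉₊ s) (v (γ ⌈|t|⌉₊ t)) t
  rw [hval]
  exact hd.congr_of_eventuallyEq hev

/-- Backward continuous dependence on initial data for a globally Lipschitz field. -/
theorem dist_le_of_integralCurve_backward {v : E → E} {K : ℝ≥0} (hv : LipschitzWith K v)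
    {f g : ℝ → E} (hf : ∀ t, HasDerivAt f (v (f t)) t) (hg : ∀ t, HasDerivAt g (v (g t)) t)
    {t : ℝ} (ht : t ≤ 0) : dist (f t) (g t) ≤ dist (f 0) (g 0) * Real.exp (K * -t) := by
  have key : ∀ {h : ℝ → E}, (∀ t, HasDerivAt h (v (h t)) t) →
      ∀ s, HasDerivAt (fun r => h (-r)) (-v (h (-s))) s := by
    intro h hh s
    simpa [Function.comp_def] using (hh (-s)).scomp s (hasDerivAt_neg s)
  have := dist_le_of_trajectories_ODE (v := fun _ x => -v x) (K := K)
    (f := fun r => f (-r)) (g := fun r => g (-r)) (a := 0) (b := -t) (δ := dist (f 0) (g 0))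
    (fun _ => hv.neg) (fun s _ => (key hf s).continuousAt.continuousWithinAt)
    (fun s _ => (key hf s).hasDerivWithinAt)
    (fun s _ => (key hg s).continuousAt.continuousWithinAt)
    (fun s _ => (key hg s).hasDerivWithinAt) (by simp) (-t) ⟨by linarith, le_rfl⟩
  simpa using this

end GlobalFlow

/-! ### Bounds for the frozen field. -/

section ClampedField

/-- The vector field of the system in a lift `(T, θ) ∈ ℝ × ℝ`. -/
noncomputable def liftField (x : ℝ × ℝ) : ℝ × ℝ :=
  (3 * x.1 * (1 - x.1) ^ 2 * Real.sin x.2 ^ 2,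
    -x.1 - 3 * (1 - x.1) * (Real.sin x.2 * Real.cos x.2))

/-- Truncation of a real number to the unit interval. -/
noncomputable def clamp (x : ℝ) : ℝ := max 0 (min 1 x)

theorem clamp_nonneg (x : ℝ) : 0 ≤ clamp x := le_max_left _ _

theorem clamp_le_one (x : ℝ) : clamp x ≤ 1 := max_le zero_le_one (min_le_left _ _)

theorem clamp_of_mem {x : ℝ} (h0 : 0 ≤ x) (h1 : x ≤ 1) : clamp x = x := by
  simp [clamp, h0, h1]

theorem clamp_of_nonpos {x : ℝ} (h : x ≤ 0) : clamp x = 0 := by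
  simp [clamp, h.trans zero_le_one, h]

theorem clamp_of_one_le {x : ℝ} (h : 1 ≤ x) : clamp x = 1 := by
  simp [clamp, h]

theorem abs_clamp_sub_clamp_le (x y : ℝ) : |clamp x - clamp y| ≤ |x - y| := by
  unfold clamp
  refine (abs_max_sub_max_le_max _ _ _ _).trans ?_
  simp only [sub_self, abs_zero]
  refine max_le (abs_nonneg _) ((abs_min_sub_min_le_max _ _ _ _).trans ?_)
  simp

theorem abs_mul_sub_mul_le {a b a' b' α β : ℝ} (ha : |a| ≤ 1) (hb : |b'| ≤ 1)
    (hα : |a - a'| ≤ α) (hβ : |b - b'| ≤ β) : |a * b - a' * b'| ≤ α + β := by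
  have e : a * b - a' * b' = a * (b - b') + (a - a') * b' := by ring
  rw [e]
  refine (abs_add_le _ _).trans ?_
  rw [abs_mul, abs_mul]
  nlinarith [abs_nonneg (b - b'), abs_nonneg (a - a'), abs_nonneg a, abs_nonneg b']

theorem abs_mul_le_one {a b : ℝ} (ha : |a| ≤ 1) (hb : |b| ≤ 1) : |a * b| ≤ 1 := by
  rw [abs_mul]
  exact mul_le_one₀ ha (abs_nonneg _) hb

/-- The field of the system, frozen outside the strip `0 ≤ T ≤ 1`. -/
noncomputable def clampedField (x : ℝ × ℝ) : ℝ × ℝ := liftField (clamp x.1, x.2)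

theorem norm_clampedField_le (x : ℝ × ℝ) : ‖clampedField x‖ ≤ (4 : NNReal) := by
  have h0 := clamp_nonneg x.1
  have h1 := clamp_le_one x.1
  have hT : |clamp x.1| ≤ 1 := abs_le.2 ⟨by linarith, h1⟩
  have hK : |1 - clamp x.1| ≤ 1 := abs_le.2 ⟨by linarith, by linarith⟩
  have hs := Real.abs_sin_le_one x.2
  have hc := Real.abs_cos_le_one x.2
  have e1 := abs_le.1 (abs_mul_le_one (abs_mul_le_one hT (abs_mul_le_one hK hK))
    (abs_mul_le_one hs hs))
  have e2 := abs_le.1 (abs_mul_le_one hK (abs_mul_le_one hs hc))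
  simp only [clampedField, liftField, Prod.norm_def, Real.norm_eq_abs]
  refine max_le (abs_le.2 ⟨?_, ?_⟩) (abs_le.2 ⟨?_, ?_⟩) <;> push_cast <;> nlinarith

/-- The first component is `3` times a product of five factors, each bounded by one and 1-Lipschitz,
whence `15 = 3 · 5`; the second needs only `1 + 3 · 3`. -/
theorem lipschitzWith_clampedField : LipschitzWith 15 clampedField := by
  refine LipschitzWith.of_dist_le_mul fun x y => ?_
  have hd1 : |clamp x.1 - clamp y.1| ≤ dist x y := by
    refine (abs_clamp_sub_clamp_le _ _).trans ?_
    rw [Prod.dist_eq, Real.dist_eq]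
    exact le_max_left _ _
  have hd2 : |x.2 - y.2| ≤ dist x y := by
    rw [Prod.dist_eq, Real.dist_eq, Real.dist_eq]
    exact le_max_right _ _
  have hsd : |Real.sin x.2 - Real.sin y.2| ≤ dist x y := (Real.abs_sin_sub_sin_le _ _).trans hd2
  have hcd : |Real.cos x.2 - Real.cos y.2| ≤ dist x y := (Real.abs_cos_sub_cos_le _ _).trans hd2
  have hk : |(1 - clamp x.1) - (1 - clamp y.1)| ≤ dist x y := by
    rw [sub_sub_sub_cancel_left, abs_sub_comm]; exact hd1
  have hT : ∀ z : ℝ × ℝ, |clamp z.1| ≤ 1 := fun z =>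
    abs_le.2 ⟨by linarith [clamp_nonneg z.1], clamp_le_one _⟩
  have hK : ∀ z : ℝ × ℝ, |1 - clamp z.1| ≤ 1 := fun z =>
    abs_le.2 ⟨by linarith [clamp_le_one z.1], by linarith [clamp_nonneg z.1]⟩
  have hs := fun z : ℝ × ℝ => Real.abs_sin_le_one z.2
  have hc := fun z : ℝ × ℝ => Real.abs_cos_le_one z.2
  have e1 := abs_le.1 (abs_mul_sub_mul_le (abs_mul_le_one (hT x) (abs_mul_le_one (hK x) (hK x)))
    (abs_mul_le_one (hs y) (hs y))
    (abs_mul_sub_mul_le (hT x) (abs_mul_le_one (hK y) (hK y)) hd1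
      (abs_mul_sub_mul_le (hK x) (hK y) hk hk))
    (abs_mul_sub_mul_le (hs x) (hs y) hsd hsd))
  have e2 := abs_le.1 (abs_mul_sub_mul_le (hK x) (abs_mul_le_one (hs y) (hc y)) hk
    (abs_mul_sub_mul_le (hs x) (hc y) hsd hcd))
  have hd := abs_le.1 hd1
  rw [Prod.dist_eq (x := clampedField x), Real.dist_eq, Real.dist_eq]
  simp only [clampedField, liftField]
  refine max_le (abs_le.2 ⟨?_, ?_⟩) (abs_le.2 ⟨?_, ?_⟩) <;> push_cast <;> nlinarith

end ClampedField

/-! ### Lifted solutions: existence, uniqueness, symmetry, invariant sets. -/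

section Lifts

/-- A solution of the system in the lift `[0, 1] × ℝ` of the closed cylinder. -/
structure IsLift (T θ : ℝ → ℝ) : Prop where
  nonneg : ∀ t, 0 ≤ T t
  le_one : ∀ t, T t ≤ 1
  deriv_T : ∀ t, HasDerivAt T (3 * T t * (1 - T t) ^ 2 * Real.sin (θ t) ^ 2) t
  deriv_θ : ∀ t, HasDerivAt θ
    (-T t - 3 * (1 - T t) * (Real.sin (θ t) * Real.cos (θ t))) t

/-- The curve in the cylinder with a given lift. -/
noncomputable def project (T θ : ℝ → ℝ) (t : ℝ) : Cyl := (T t, (θ t : Real.Angle))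

theorem field_coe (T θ : ℝ) : field (T, (θ : Real.Angle)) = liftField (T, θ) := by
  simp only [field, liftField, Real.Angle.sin_two_nsmul, Real.Angle.sin_coe, Real.Angle.cos_coe,
    nsmul_eq_mul, Prod.mk.injEq, true_and]
  push_cast
  ring

theorem isSolution_iff {c : ℝ → Cyl} :
    IsSolution c ↔ ∃ T θ, IsLift T θ ∧ c = project T θ := by
  constructor
  · rintro ⟨h, T, θ, hc, hd⟩
    refine ⟨T, θ, ⟨fun t => ?_, fun t => ?_, fun t => ?_, fun t => ?_⟩, funext hc⟩
    · simpa [hc] using (h t).1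
    · simpa [hc] using (h t).2
    · simpa [hc, field_coe, liftField] using (hd t).1
    · simpa [hc, field_coe, liftField] using (hd t).2
  · rintro ⟨T, θ, h, rfl⟩
    refine ⟨fun t => ⟨h.nonneg t, h.le_one t⟩, T, θ, fun _ => rfl, fun t => ?_⟩
    simp only [project, field_coe, liftField]
    exact ⟨h.deriv_T t, h.deriv_θ t⟩

theorem IsLift.isSolution {T θ : ℝ → ℝ} (h : IsLift T θ) : IsSolution (project T θ) :=
  isSolution_iff.2 ⟨T, θ, h, rfl⟩

theorem IsLift.hasDerivAt_clampedField {T θ : ℝ → ℝ} (h : IsLift T θ) (t : ℝ) :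
    HasDerivAt (fun s => (T s, θ s)) (clampedField (T t, θ t)) t := by
  simp only [clampedField, liftField, clamp_of_mem (h.nonneg t) (h.le_one t)]
  exact (h.deriv_T t).prodMk (h.deriv_θ t)

/-- The `T`-component of the clamped field at a fixed angle is Lipschitz. -/
theorem lipschitzWith_clampedField_fst (θ : ℝ) :
    LipschitzWith 15 fun x : ℝ => (clampedField (x, θ)).1 := by
  have h1 : LipschitzWith 1 fun x : ℝ => (x, θ) :=
    LipschitzWith.of_dist_le_mul fun x y => by simp [Prod.dist_eq]
  simpa [Function.comp_def] using
    LipschitzWith.prod_fst.comp (lipschitzWith_clampedField.comp h1)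

/-- For a given `θ` the constant `a` solves the scalar equation for `T`, because the frozen first
component vanishes for `T ≤ 0` and for `T ≥ 1`. This confines frozen solutions to the strip and
makes the boundary circles invariant. -/
theorem eq_const_of_clampedField {T θ : ℝ → ℝ} {a t₀ : ℝ}
    (hT : ∀ t, HasDerivAt T (clampedField (T t, θ t)).1 t)
    (ha : clamp a = 0 ∨ clamp a = 1) (h0 : T t₀ = a) : T = fun _ => a := by
  refine ODE_solution_unique_univ (v := fun t x => (clampedField (x, θ t)).1) (K := 15)
    (s := fun _ => univ) (t₀ := t₀)
    (fun t => (lipschitzWith_clampedField_fst (θ t)).lipschitzOnWith)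
    (fun t => ⟨hT t, mem_univ _⟩) (fun t => ⟨?_, mem_univ _⟩) h0
  have : (clampedField (a, θ t)).1 = 0 := by
    rcases ha with ha | ha <;> simp [clampedField, liftField, ha]
  rw [this]
  exact hasDerivAt_const t a

theorem exists_isLift (T₀ θ₀ : ℝ) (h0 : 0 ≤ T₀) (h1 : T₀ ≤ 1) :
    ∃ T θ, IsLift T θ ∧ T 0 = T₀ ∧ θ 0 = θ₀ := by
  obtain ⟨γ, hγ0, hγ⟩ := exists_global_integralCurve lipschitzWith_clampedField
    norm_clampedField_le (T₀, θ₀)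
  have hT : ∀ t, HasDerivAt (fun s => (γ s).1) (clampedField ((γ t).1, (γ t).2)).1 t :=
    fun t => (ContinuousLinearMap.fst ℝ ℝ ℝ).hasFDerivAt.comp_hasDerivAt t (hγ t)
  have hθ : ∀ t, HasDerivAt (fun s => (γ s).2) (clampedField ((γ t).1, (γ t).2)).2 t :=
    fun t => (ContinuousLinearMap.snd ℝ ℝ ℝ).hasFDerivAt.comp_hasDerivAt t (hγ t)
  have hT0 : (γ 0).1 = T₀ := by rw [hγ0]
  have hnn : ∀ t, 0 ≤ (γ t).1 := by
    intro t
    by_contra! hneg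
    have hconst := eq_const_of_clampedField hT (a := (γ t).1) (t₀ := t)
      (Or.inl (clamp_of_nonpos hneg.le)) rfl
    have := congrFun hconst 0
    linarith
  have hle : ∀ t, (γ t).1 ≤ 1 := by
    intro t
    by_contra! hgt
    have hconst := eq_const_of_clampedField hT (a := (γ t).1) (t₀ := t)
      (Or.inr (clamp_of_one_le hgt.le)) rfl
    have := congrFun hconst 0
    linarith
  refine ⟨fun t => (γ t).1, fun t => (γ t).2, ⟨hnn, hle, fun t => ?_, fun t => ?_⟩, hT0,
    by simp only [hγ0]⟩
  · have := hT t
    simpa only [clampedField, liftField, clamp_of_mem (hnn t) (hle t)] using this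
  · have := hθ t
    simpa only [clampedField, liftField, clamp_of_mem (hnn t) (hle t)] using this

theorem IsLift.ext_of_eq {T θ T' θ' : ℝ → ℝ} (h : IsLift T θ) (h' : IsLift T' θ') {t₀ : ℝ}
    (hT : T t₀ = T' t₀) (hθ : θ t₀ = θ' t₀) : T = T' ∧ θ = θ' := by
  have := ODE_solution_unique_univ (v := fun _ => clampedField) (K := 15) (s := fun _ => univ)
    (t₀ := t₀) (fun _ => lipschitzWith_clampedField.lipschitzOnWith)
    (fun t => ⟨h.hasDerivAt_clampedField t, mem_univ _⟩)
    (fun t => ⟨h'.hasDerivAt_clampedField t, mem_univ _⟩) (by simp [hT, hθ])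
  exact ⟨funext fun t => congrArg Prod.fst (congrFun this t),
    funext fun t => congrArg Prod.snd (congrFun this t)⟩

theorem IsLift.add_const {T θ : ℝ → ℝ} (h : IsLift T θ) {a : ℝ}
    (ha : ∀ x, Real.sin (x + a) ^ 2 = Real.sin x ^ 2)
    (ha' : ∀ x, Real.sin (x + a) * Real.cos (x + a) = Real.sin x * Real.cos x) :
    IsLift T fun t => θ t + a where
  nonneg := h.nonneg
  le_one := h.le_one
  deriv_T t := by simpa only [ha] using h.deriv_T t
  deriv_θ t := by simpa only [ha'] using (h.deriv_θ t).add_const a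

theorem IsLift.add_pi {T θ : ℝ → ℝ} (h : IsLift T θ) : IsLift T fun t => θ t + Real.pi :=
  h.add_const (fun x => by simp) (fun x => by simp)

theorem IsLift.add_two_pi {T θ : ℝ → ℝ} (h : IsLift T θ) (n : ℤ) :
    IsLift T fun t => θ t + n * (2 * Real.pi) :=
  h.add_const (fun x => by simp) (fun x => by simp)

theorem IsLift.shift {T θ : ℝ → ℝ} (h : IsLift T θ) (a : ℝ) :
    IsLift (fun t => T (t + a)) fun t => θ (t + a) where
  nonneg _ := h.nonneg _
  le_one _ := h.le_one _
  deriv_T t := (h.deriv_T (t + a)).comp_add_const t a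
  deriv_θ t := (h.deriv_θ (t + a)).comp_add_const t a

theorem eq_of_isSolution {c c' : ℝ → Cyl} (hc : IsSolution c) (hc' : IsSolution c') {t₀ : ℝ}
    (h : c t₀ = c' t₀) : c = c' := by
  obtain ⟨T, θ, hl, rfl⟩ := isSolution_iff.1 hc
  obtain ⟨T', θ', hl', rfl⟩ := isSolution_iff.1 hc'
  have hT : T t₀ = T' t₀ := congrArg Prod.fst h
  have hθ : (θ t₀ : Real.Angle) = θ' t₀ := congrArg Prod.snd h
  -- Equal angles fix the lifts only up to a multiple of `2π`, which is absorbed by translating one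
  -- lift.
  obtain ⟨n, hn⟩ := Real.Angle.angle_eq_iff_two_pi_dvd_sub.1 hθ
  obtain ⟨e1, e2⟩ := hl.ext_of_eq (hl'.add_two_pi n) hT (by linarith)
  funext t
  rw [project, project, e1, e2]
  simp

theorem existsUnique_isSolution {p : Cyl} (hp : p ∈ closedState) :
    ∃! c : ℝ → Cyl, IsSolution c ∧ c 0 = p := by
  obtain ⟨T₀, φ⟩ := p
  induction φ using Real.Angle.induction_on with
  | h θ₀ =>
    obtain ⟨T, θ, hl, hT, hθ⟩ := exists_isLift T₀ θ₀ hp.1 hp.2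
    have h0 : project T θ 0 = (T₀, (θ₀ : Real.Angle)) := by rw [project, hT, hθ]
    exact ⟨project T θ, ⟨hl.isSolution, h0⟩,
      fun c hc => eq_of_isSolution hc.1 hl.isSolution (hc.2.trans h0.symm)⟩

theorem isSolution_shift {c : ℝ → Cyl} (hc : IsSolution c) (a : ℝ) :
    IsSolution fun t => c (t + a) := by
  obtain ⟨T, θ, hl, rfl⟩ := isSolution_iff.1 hc
  exact (hl.shift a).isSolution

theorem range_eq_of_mem_inter {c c' : ℝ → Cyl} (hc : IsSolution c) (hc' : IsSolution c') {s t : ℝ}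
    (h : c s = c' t) : range c = range c' := by
  have key : c = fun r => c' (r + (t - s)) :=
    eq_of_isSolution hc (isSolution_shift hc' _) (t₀ := s) (by simpa using h)
  rw [key]
  exact (Equiv.addRight (t - s)).surjective.range_comp c'

theorem isSolution_halfTurn {c : ℝ → Cyl} (hc : IsSolution c) :
    IsSolution fun t => halfTurn (c t) := by
  obtain ⟨T, θ, hl, rfl⟩ := isSolution_iff.1 hc
  refine isSolution_iff.2 ⟨_, _, hl.add_pi, ?_⟩
  funext t
  simp [project, halfTurn]

theorem IsLift.hasDerivAt_clampedField_fst {T θ : ℝ → ℝ} (h : IsLift T θ) (t : ℝ) :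
    HasDerivAt T (clampedField (T t, θ t)).1 t := by
  simp only [clampedField, liftField, clamp_of_mem (h.nonneg t) (h.le_one t)]
  exact h.deriv_T t

theorem IsLift.eq_zero {T θ : ℝ → ℝ} (h : IsLift T θ) {t₀ : ℝ} (h0 : T t₀ = 0) (t : ℝ) : T t = 0 :=
  congrFun (eq_const_of_clampedField h.hasDerivAt_clampedField_fst
    (Or.inl (clamp_of_nonpos le_rfl)) h0) t

theorem IsLift.eq_one {T θ : ℝ → ℝ} (h : IsLift T θ) {t₀ : ℝ} (h0 : T t₀ = 1) (t : ℝ) : T t = 1 :=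
  congrFun (eq_const_of_clampedField h.hasDerivAt_clampedField_fst
    (Or.inr (clamp_of_one_le le_rfl)) h0) t

theorem IsLift.pos {T θ : ℝ → ℝ} (h : IsLift T θ) {t₀ : ℝ} (h0 : 0 < T t₀) (t : ℝ) : 0 < T t :=
  lt_of_le_of_ne (h.nonneg t) fun e => h0.ne' (h.eq_zero e.symm t₀)

theorem IsLift.lt_one {T θ : ℝ → ℝ} (h : IsLift T θ) {t₀ : ℝ} (h0 : T t₀ < 1) (t : ℝ) : T t < 1 :=
  lt_of_le_of_ne (h.le_one t) fun e => h0.ne (h.eq_one e t₀)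

theorem isSolution_invariant {c : ℝ → Cyl} (hc : IsSolution c) (t : ℝ) :
    (c 0 ∈ state ↔ c t ∈ state) ∧ (c 0 ∈ bottom ↔ c t ∈ bottom) ∧
      (c 0 ∈ top ↔ c t ∈ top) := by
  obtain ⟨T, θ, h, rfl⟩ := isSolution_iff.1 hc
  exact ⟨⟨fun k => ⟨h.pos k.1 t, h.lt_one k.2 t⟩, fun k => ⟨h.pos k.1 0, h.lt_one k.2 0⟩⟩,
    ⟨fun k => h.eq_zero k t, fun k => h.eq_zero k 0⟩,
    ⟨fun k => h.eq_one k t, fun k => h.eq_one k 0⟩⟩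

end Lifts

/-! ### Comparison arguments and convergence criteria. -/

section RealAnalysis

/-- The contradiction closing the limit arguments: by the mean value inequality `f` exceeds `B` by
time `t₀ + (B - f t₀ + 1) / ε`. -/
theorem false_of_deriv_ge_of_le {f f' : ℝ → ℝ} {t₀ ε B : ℝ} (hε : 0 < ε)
    (hf : ∀ t ≥ t₀, HasDerivAt f (f' t) t) (hf' : ∀ t ≥ t₀, ε ≤ f' t) (hB : ∀ t ≥ t₀, f t ≤ B) :
    False := by
  have key := Convex.mul_sub_le_image_sub_of_le_deriv (convex_Ici t₀) (f := f) (C := ε)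
    (fun t ht => (hf t ht).continuousAt.continuousWithinAt)
    (fun t ht => (hf t (interior_subset ht)).differentiableAt.differentiableWithinAt)
    (fun t ht => by rw [(hf t (interior_subset ht)).deriv]; exact hf' t (interior_subset ht))
  have hfB := hB t₀ le_rfl
  set t := t₀ + (B - f t₀ + 1) / ε with ht
  have htt : t₀ ≤ t := le_add_of_nonneg_right (div_nonneg (by linarith) hε.le)
  have h1 := key t₀ self_mem_Ici t htt htt
  have h2 : ε * (t - t₀) = B - f t₀ + 1 := by
    rw [ht]; field_simp; ring
  linarith [hB t htt]

theorem false_of_deriv_le_of_le {f f' : ℝ → ℝ} {t₀ ε B : ℝ} (hε : 0 < ε)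
    (hf : ∀ t, HasDerivAt f (f' t) t) (hf' : ∀ t ≤ t₀, f' t ≤ -ε) (hB : ∀ t ≤ t₀, f t ≤ B) :
    False := by
  refine false_of_deriv_ge_of_le (f := fun t => f (-t)) (f' := fun t => -f' (-t)) (t₀ := -t₀)
    hε (fun t _ => ?_) (fun t ht => ?_) (B := B) (fun t ht => hB _ (by linarith))
  · simpa [Function.comp_def] using (hf (-t)).comp t (hasDerivAt_neg t)
  · linarith [hf' (-t) (by linarith)]

/-- A function with `f' ≤ -a f`, `a ≥ 0`, that is nonnegative at `t₁` is larger before `t₁`. -/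
theorem le_of_deriv_le_neg_mul {f f' a : ℝ → ℝ} {t₁ : ℝ} (ha : Continuous a) (ha0 : ∀ t, 0 ≤ a t)
    (hf : ∀ t, HasDerivAt f (f' t) t) (hf' : ∀ t < t₁, f' t ≤ -a t * f t) (h₁ : 0 ≤ f t₁)
    {t : ℝ} (ht : t ≤ t₁) : f t₁ ≤ f t := by
  -- With the integrating factor `exp A`, the product `f exp A` is antitone up to `t₁`; since `A`
  -- increases and `f t₁ ≥ 0`, the factor can then be dropped.
  set A : ℝ → ℝ := fun t => ∫ s in (0 : ℝ)..t, a s with hA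
  have hAd : ∀ t, HasDerivAt A (a t) t := fun t =>
    (ha.integral_hasStrictDerivAt 0 t).hasDerivAt
  have hAm : Monotone A := monotone_of_hasDerivAt_nonneg hAd ha0
  have hg : ∀ t, HasDerivAt (fun t => f t * Real.exp (A t))
      (f' t * Real.exp (A t) + f t * (Real.exp (A t) * a t)) t := fun t =>
    (hf t).mul (hAd t).exp
  have hanti : AntitoneOn (fun t => f t * Real.exp (A t)) (Iic t₁) := by
    refine antitoneOn_of_deriv_nonpos (convex_Iic t₁)
      (fun t _ => (hg t).continuousAt.continuousWithinAt)
      (fun t _ => (hg t).differentiableAt.differentiableWithinAt) fun t ht => ?_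
    rw [interior_Iic] at ht
    rw [(hg t).deriv]
    have := mul_le_mul_of_nonneg_right (hf' t ht) (Real.exp_pos (A t)).le
    linarith
  have h2 : f t₁ * Real.exp (A t₁) ≤ f t * Real.exp (A t) := hanti ht self_mem_Iic ht
  have h3 : Real.exp (A t) ≤ Real.exp (A t₁) := Real.exp_le_exp.2 (hAm ht)
  have h4 : f t₁ * Real.exp (A t) ≤ f t₁ * Real.exp (A t₁) := mul_le_mul_of_nonneg_left h3 h₁
  exact le_of_mul_le_mul_right (h4.trans h2) (Real.exp_pos _)

/-- By compactness a filter whose only cluster point is `a` converges to `a`, and a cluster point of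
the comap must map to `f a`. Convergence of an angle thus reduces to that of its sine or cosine at
an extreme value. -/
theorem nhds_eq_comap_of_preimage_singleton {X Y : Type*} [TopologicalSpace X] [CompactSpace X]
    [TopologicalSpace Y] [T2Space Y] {f : X → Y} (hf : Continuous f) {a : X}
    (ha : ∀ x, f x = f a → x = a) : 𝓝 a = comap f (𝓝 (f a)) := by
  refine le_antisymm hf.continuousAt.le_comap (le_nhds_of_unique_clusterPt fun x hx => ha x ?_)
  have h1 : ClusterPt (f x) (𝓝 (f a)) :=
    (hx.map hf.continuousAt tendsto_map).mono map_comap_le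
  exact (eq_of_nhds_neBot h1)

instance : CompactSpace Real.Angle :=
  haveI : Fact (0 < 2 * Real.pi) := ⟨Real.two_pi_pos⟩
  inferInstanceAs (CompactSpace (AddCircle (2 * Real.pi)))

theorem nhds_angle_pi_div_two :
    𝓝 ((Real.pi / 2 : ℝ) : Real.Angle) = comap Real.Angle.sin (𝓝 1) := by
  have h := nhds_eq_comap_of_preimage_singleton (a := ((Real.pi / 2 : ℝ) : Real.Angle))
    Real.Angle.continuous_sin fun x hx => ?_
  · simpa using h
  · rcases Real.Angle.sin_eq_iff_eq_or_add_eq_pi.1 hx with h | h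
    · exact h
    · rw [← eq_sub_iff_add_eq] at h
      rw [h, ← Real.Angle.coe_sub, sub_half]

theorem nhds_angle_zero : 𝓝 (0 : Real.Angle) = comap Real.Angle.cos (𝓝 1) := by
  have h := nhds_eq_comap_of_preimage_singleton (a := (0 : Real.Angle))
    Real.Angle.continuous_cos fun x hx => ?_
  · simpa using h
  · rcases Real.Angle.cos_eq_iff_eq_or_eq_neg.1 hx with h | h
    · exact h
    · simpa using h

theorem tendsto_MPlus {c : ℝ → Cyl} {l : Filter ℝ} (hT : Tendsto (fun t => (c t).1) l (𝓝 0))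
    (hs : Tendsto (fun t => (c t).2.sin) l (𝓝 1)) : Tendsto c l (𝓝 MPlus) := by
  rw [MPlus, nhds_prod_eq]
  refine hT.prodMk ?_
  rw [nhds_angle_pi_div_two]
  exact tendsto_comap_iff.2 hs

theorem tendsto_dSPlus {c : ℝ → Cyl} {l : Filter ℝ} (hT : Tendsto (fun t => (c t).1) l (𝓝 0))
    (hs : Tendsto (fun t => (c t).2.cos) l (𝓝 1)) : Tendsto c l (𝓝 dSPlus) := by
  rw [dSPlus, nhds_prod_eq, Real.Angle.coe_zero]
  refine hT.prodMk ?_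
  rw [nhds_angle_zero]
  exact tendsto_comap_iff.2 hs

theorem mapClusterPt_iff_eq_of_tendsto {X ι : Type*} [TopologicalSpace X] [T2Space X]
    {c : ι → X} {l : Filter ι} [l.NeBot] {p q : X} (h : Tendsto c l (𝓝 p)) :
    MapClusterPt q l c ↔ q = p := by
  refine ⟨fun hq => ?_, fun e => e ▸ h.mapClusterPt⟩
  exact eq_of_nhds_neBot (ClusterPt.mono hq h)

theorem alphaSet_eq_of_tendsto {c : ℝ → Cyl} {p : Cyl} (h : Tendsto c atBot (𝓝 p)) :
    alphaSet c = {p} :=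
  ext fun _ => mapClusterPt_iff_eq_of_tendsto h

theorem omegaSet_eq_of_tendsto {c : ℝ → Cyl} {p : Cyl} (h : Tendsto c atTop (𝓝 p)) :
    omegaSet c = {p} :=
  ext fun _ => mapClusterPt_iff_eq_of_tendsto h

theorem isCompact_closedState : IsCompact closedState := by
  have : closedState = Icc (0 : ℝ) 1 ×ˢ (univ : Set Real.Angle) := by
    ext p; simp [closedState]
  rw [this]
  exact isCompact_Icc.prod isCompact_univ

theorem tendsto_of_alphaSet_eq {c : ℝ → Cyl} (hc : IsSolution c) {p : Cyl}
    (h : alphaSet c = {p}) : Tendsto c atBot (𝓝 p) := by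
  refine isCompact_closedState.le_nhds_of_unique_clusterPt
    (mem_map.2 (univ_mem' hc.1)) fun x _ hx => ?_
  have : x ∈ alphaSet c := hx
  rwa [h] at this

end RealAnalysis

/-! ### Growth of `T` and its limits at both ends of time. -/

section Monotonicity

variable {T θ : ℝ → ℝ}

theorem IsLift.monotone (h : IsLift T θ) : Monotone T :=
  monotone_of_hasDerivAt_nonneg h.deriv_T fun t => by
    have := h.nonneg t
    positivity

/-- If `T` were constant on an interval, `sin θ` would vanish on it; but where `sin θ = 0`, the
derivative of `sin θ` is `-T cos θ ≠ 0`. -/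
theorem IsLift.strictMono (h : IsLift T θ) (h0 : ∀ t, 0 < T t) (h1 : ∀ t, T t < 1) :
    StrictMono T := by
  intro a b hab
  refine lt_of_le_of_ne (h.monotone hab.le) fun e => ?_
  have hconst : ∀ t ∈ Ioo a b, T t = T a := fun t ht =>
    le_antisymm ((h.monotone ht.2.le).trans e.ge) (h.monotone ht.1.le)
  have hsin : ∀ t ∈ Ioo a b, Real.sin (θ t) = 0 := by
    intro t ht
    have hev : T =ᶠ[𝓝 t] fun _ => T a :=
      eventually_of_mem (isOpen_Ioo.mem_nhds ht) hconst
    have h2 := (h.deriv_T t).unique ((hasDerivAt_const t (T a)).congr_of_eventuallyEq hev)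
    have h3 : 3 * T t * (1 - T t) ^ 2 ≠ 0 := by
      have := h0 t
      have := sub_pos.2 (h1 t)
      positivity
    simpa using (mul_eq_zero.1 h2).resolve_left h3
  obtain ⟨t, ht⟩ := nonempty_Ioo.2 hab
  have hev : (fun t => Real.sin (θ t)) =ᶠ[𝓝 t] fun _ => 0 :=
    eventually_of_mem (isOpen_Ioo.mem_nhds ht) hsin
  have h2 := (h.deriv_θ t).sin.unique ((hasDerivAt_const t (0 : ℝ)).congr_of_eventuallyEq hev)
  have hs := hsin t ht
  have hc : Real.cos (θ t) ≠ 0 := fun hc => by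
    have := Real.sin_sq_add_cos_sq (θ t)
    simp [hs, hc] at this
  rw [hs] at h2
  have := (mul_eq_zero.1 h2).resolve_left hc
  linarith [h0 t]

/-- As long as `T` stays in a compact part of `(0, 1)`, the function `sin θ cos θ - C T` decreases
at a uniform rate. -/
theorem deriv_sin_mul_cos_sub_le {m M x s c : ℝ} (hm : 0 < m) (hM : M < 1) (hmx : m ≤ x)
    (hxM : x ≤ M) (hsc : s ^ 2 + c ^ 2 = 1) :
    (c ^ 2 - s ^ 2) * (-x - 3 * (1 - x) * (s * c)) -
      ((8 + 9 / (2 * m)) / (3 * m * (1 - M) ^ 2)) * (3 * x * (1 - x) ^ 2 * s ^ 2) ≤ -(m / 2) := by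
  have hM' : 0 < 1 - M := by linarith
  -- Using `c² - s² = 1 - 2 s²`, the first product is at most `-m + 3 |s| + 8 s²`, and `3 |s| ≤ m /
  -- 2 + 9 s² / (2 m)`. The constant `C` is tuned to absorb all the `s²` terms.
  set C := (8 + 9 / (2 * m)) / (3 * m * (1 - M) ^ 2) with hC
  have hCpos : 0 < C := by positivity
  have e1 : C * (3 * m * (1 - M) ^ 2) = 8 + 9 / (2 * m) := by
    rw [hC]; field_simp
  have hs2 : s ^ 2 ≤ 1 := by nlinarith
  have e2 : (8 + 9 / (2 * m)) * s ^ 2 ≤ C * (3 * x * (1 - x) ^ 2 * s ^ 2) := by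
    rw [← e1]
    have : m * (1 - M) ^ 2 ≤ x * (1 - x) ^ 2 := by
      have : (1 - M) ^ 2 ≤ (1 - x) ^ 2 := by nlinarith
      exact mul_le_mul hmx this (by positivity) (by linarith)
    have h2 := mul_le_mul_of_nonneg_right (mul_le_mul_of_nonneg_left this hCpos.le) (sq_nonneg s)
    nlinarith
  have e3 : 3 * |s| ≤ m / 2 + 9 / (2 * m) * s ^ 2 := by
    have : m / 2 + 9 / (2 * m) * s ^ 2 - 3 * |s| = (m - 3 * |s|) ^ 2 / (2 * m) := by
      rw [← sq_abs s]; field_simp; ring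
    have : 0 ≤ (m - 3 * |s|) ^ 2 / (2 * m) := by positivity
    linarith
  have hk : |1 - x| ≤ 1 := abs_le.2 ⟨by linarith, by linarith⟩
  have hc1 : |c| ≤ 1 := abs_le_one_iff_mul_self_le_one.2 (by nlinarith)
  have e4 : |(1 - x) * (s * c)| ≤ |s| := by
    rw [abs_mul, abs_mul]
    have := abs_nonneg s
    calc |1 - x| * (|s| * |c|) ≤ 1 * (|s| * 1) := by gcongr
      _ = |s| := by ring
  have hs1 : |s| ≤ 1 := abs_le_one_iff_mul_self_le_one.2 (by nlinarith)
  have e5 := abs_le.1 e4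
  have e6 : s ^ 2 * (x + 3 * ((1 - x) * (s * c))) ≤ s ^ 2 * 4 :=
    mul_le_mul_of_nonneg_left (by linarith) (sq_nonneg s)
  have e7 : c ^ 2 = 1 - s ^ 2 := by linarith
  rw [e7]
  nlinarith

theorem IsLift.hasDerivAt_sin_mul_cos_sub (h : IsLift T θ) (C t : ℝ) :
    HasDerivAt (fun t => Real.sin (θ t) * Real.cos (θ t) - C * T t)
      ((Real.cos (θ t) ^ 2 - Real.sin (θ t) ^ 2) *
        (-T t - 3 * (1 - T t) * (Real.sin (θ t) * Real.cos (θ t))) -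
        C * (3 * T t * (1 - T t) ^ 2 * Real.sin (θ t) ^ 2)) t := by
  refine (((h.deriv_θ t).sin.mul (h.deriv_θ t).cos).sub ((h.deriv_T t).const_mul C)).congr_deriv ?_
  ring

theorem abs_sin_mul_cos_sub_le {x C y : ℝ} (hC : 0 ≤ C) (h0 : 0 ≤ x) (h1 : x ≤ 1) :
    |Real.sin y * Real.cos y - C * x| ≤ 1 + C := by
  have h2 := abs_le.1 (abs_mul_le_one (Real.abs_sin_le_one y) (Real.abs_cos_le_one y))
  exact abs_le.2 ⟨by nlinarith, by nlinarith⟩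

theorem IsLift.tendsto_one (h : IsLift T θ) (h0 : ∀ t, 0 < T t) : Tendsto T atTop (𝓝 1) := by
  refine tendsto_order.2 ⟨fun a ha => ?_, fun a ha => .of_forall fun t => (h.le_one t).trans_lt ha⟩
  by_contra hcon
  have hle : ∀ t, T t ≤ a := by
    intro t
    by_contra! hlt
    exact hcon ((eventually_ge_atTop t).mono fun s hs => hlt.trans_le (h.monotone hs))
  set C := (8 + 9 / (2 * T 0)) / (3 * T 0 * (1 - a) ^ 2)
  have hC : 0 ≤ C := by
    have := h0 0
    positivity
  refine false_of_deriv_ge_of_le (half_pos (h0 0))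
    (fun t _ => (h.hasDerivAt_sin_mul_cos_sub C t).neg) (t₀ := 0) (B := 1 + C)
    (fun t ht => ?_) fun t _ => ?_
  · linarith [deriv_sin_mul_cos_sub_le (h0 0) ha (h.monotone ht) (hle t)
      (Real.sin_sq_add_cos_sq (θ t))]
  · have := abs_le.1 (abs_sin_mul_cos_sub_le (y := θ t) hC (h.nonneg t) (h.le_one t))
    show -(_ - _) ≤ _
    linarith

/-- A positive lower bound on `T` would trap the past in `[a, T 0]`, where the bounded function `sin
θ cos θ - C T` would grow without limit backwards. Solutions on `T = 0` are included, so the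
backward analysis also serves the bottom circle. -/
theorem IsLift.tendsto_zero (h : IsLift T θ) (h1 : ∀ t, T t < 1) : Tendsto T atBot (𝓝 0) := by
  refine tendsto_order.2 ⟨fun a ha => .of_forall fun t => ha.trans_le (h.nonneg t), fun a ha => ?_⟩
  by_contra hcon
  have hle : ∀ t, a ≤ T t := by
    intro t
    by_contra! hlt
    exact hcon ((eventually_le_atBot t).mono fun s hs => (h.monotone hs).trans_lt hlt)
  set C := (8 + 9 / (2 * a)) / (3 * a * (1 - T 0) ^ 2)
  have hC : 0 ≤ C := by positivity
  refine false_of_deriv_le_of_le (half_pos ha)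
    (fun t => h.hasDerivAt_sin_mul_cos_sub C t) (t₀ := 0) (B := 1 + C)
    (fun t ht => ?_) fun t _ => ?_
  · exact deriv_sin_mul_cos_sub_le ha (h1 0) (hle t) (h.monotone ht)
      (Real.sin_sq_add_cos_sq (θ t))
  · exact (abs_le.1 (abs_sin_mul_cos_sub_le (y := θ t) hC (h.nonneg t) (h.le_one t))).2

end Monotonicity

/-! ### The barrier and convergence to the massless scalar field points. -/

section Sources

variable {T θ : ℝ → ℝ}

theorem IsLift.continuous_T (h : IsLift T θ) : Continuous T :=
  continuous_iff_continuousAt.2 fun t => (h.deriv_T t).continuousAt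

theorem IsLift.continuous_θ (h : IsLift T θ) : Continuous θ :=
  continuous_iff_continuousAt.2 fun t => (h.deriv_θ t).continuousAt

/-- The variable `T / (1 - T)`, proportional to the inverse of the Hubble variable. -/
noncomputable def odds (x : ℝ) : ℝ := x / (1 - x)

theorem odds_nonneg {x : ℝ} (h0 : 0 ≤ x) (h1 : x < 1) : 0 ≤ odds x :=
  div_nonneg h0 (by linarith)

theorem odds_pos {x : ℝ} (h0 : 0 < x) (h1 : x < 1) : 0 < odds x :=
  div_pos h0 (by linarith)

theorem one_sub_mul_odds {x : ℝ} (h1 : x < 1) : (1 - x) * odds x = x :=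
  mul_div_cancel₀ _ (by linarith)

theorem continuousAt_odds {x : ℝ} (h1 : x < 1) : ContinuousAt odds x :=
  continuousAt_id.div (continuousAt_const.sub continuousAt_id) (by simp; linarith)

/-- With `u = odds T`, the derivatives of `u`, `sin θ` and `cos θ` share the factor `1 - T`, in
effect a change of time. -/
theorem IsLift.hasDerivAt_odds (h : IsLift T θ) (h1 : ∀ t, T t < 1) (t : ℝ) :
    HasDerivAt (fun t => odds (T t))
      (3 * (1 - T t) * odds (T t) * Real.sin (θ t) ^ 2) t := by
  have hk : 1 - T t ≠ 0 := by linarith [h1 t]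
  refine ((h.deriv_T t).div ((h.deriv_T t).const_sub 1) hk).congr_deriv ?_
  rw [odds]
  field_simp
  ring

theorem IsLift.hasDerivAt_sin (h : IsLift T θ) (h1 : ∀ t, T t < 1) (t : ℝ) :
    HasDerivAt (fun t => Real.sin (θ t)) (-(1 - T t) * Real.cos (θ t) *
      (odds (T t) + 3 * Real.sin (θ t) * Real.cos (θ t))) t := by
  refine (h.deriv_θ t).sin.congr_deriv ?_
  linear_combination (Real.cos (θ t)) * one_sub_mul_odds (h1 t)

theorem IsLift.hasDerivAt_cos (h : IsLift T θ) (h1 : ∀ t, T t < 1) (t : ℝ) :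
    HasDerivAt (fun t => Real.cos (θ t)) ((1 - T t) * Real.sin (θ t) *
      (odds (T t) + 3 * Real.sin (θ t) * Real.cos (θ t))) t := by
  refine (h.deriv_θ t).cos.congr_deriv ?_
  linear_combination (-Real.sin (θ t)) * one_sub_mul_odds (h1 t)

/-- The signed distance of `sin θ` from the barrier `T / (3 (1 - T))`. -/
noncomputable def barrier (T θ : ℝ → ℝ) (t : ℝ) : ℝ := Real.sin (θ t) - odds (T t) / 3

/-- The coefficient `1/3` is what lets `sin² + cos² = 1` collect the remaining terms into `u (1 +
cos θ)`, which has a sign for every angle. -/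
theorem IsLift.hasDerivAt_barrier (h : IsLift T θ) (h1 : ∀ t, T t < 1) (t : ℝ) :
    HasDerivAt (barrier T θ) (-(1 - T t) * (3 * Real.cos (θ t) ^ 2 * barrier T θ t +
      odds (T t) * (1 + Real.cos (θ t)))) t := by
  refine ((h.hasDerivAt_sin h1 t).sub ((h.hasDerivAt_odds h1 t).div_const 3)).congr_deriv ?_
  rw [barrier]
  linear_combination ((1 - T t) * odds (T t)) * (-Real.sin_sq_add_cos_sq (θ t))

theorem IsLift.deriv_barrier_le (h : IsLift T θ) (h1 : ∀ t, T t < 1) (t : ℝ) :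
    -(1 - T t) * (3 * Real.cos (θ t) ^ 2 * barrier T θ t +
      odds (T t) * (1 + Real.cos (θ t))) ≤
    -(3 * (1 - T t) * Real.cos (θ t) ^ 2) * barrier T θ t := by
  have hk : 0 ≤ 1 - T t := by linarith [h1 t]
  have hu := odds_nonneg (h.nonneg t) (h1 t)
  have hc : 0 ≤ 1 + Real.cos (θ t) := by linarith [Real.neg_one_le_cos (θ t)]
  have := mul_nonneg hk (mul_nonneg hu hc)
  linarith

theorem IsLift.barrier_le (h : IsLift T θ) (h1 : ∀ t, T t < 1) {t₁ : ℝ}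
    (hb : 0 ≤ barrier T θ t₁) {t : ℝ} (ht : t ≤ t₁) : barrier T θ t₁ ≤ barrier T θ t := by
  have hcT := h.continuous_T
  have hcθ := h.continuous_θ
  refine le_of_deriv_le_neg_mul (a := fun t => 3 * (1 - T t) * Real.cos (θ t) ^ 2) (by fun_prop)
    (fun t => ?_) (h.hasDerivAt_barrier h1) (fun t _ => h.deriv_barrier_le h1 t) hb ht
  have := h1 t
  have : 0 ≤ 1 - T t := by linarith
  positivity

theorem IsLift.barrier_le_sin (h : IsLift T θ) (h1 : ∀ t, T t < 1) (t : ℝ) :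
    barrier T θ t ≤ Real.sin (θ t) := by
  have := odds_nonneg (h.nonneg t) (h1 t)
  rw [barrier]; linarith

theorem IsLift.tendsto_odds (h : IsLift T θ) (h1 : ∀ t, T t < 1) :
    Tendsto (fun t => odds (T t)) atBot (𝓝 0) := by
  have h0 : odds 0 = 0 := by simp [odds]
  have := (continuousAt_odds zero_lt_one).tendsto.comp (h.tendsto_zero h1)
  rwa [h0] at this

theorem IsLift.tendsto_sin_one (h : IsLift T θ) (h1 : ∀ t, T t < 1) {t₁ : ℝ}
    (hb : 0 < barrier T θ t₁) : Tendsto (fun t => Real.sin (θ t)) atBot (𝓝 1) := by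
  have hge : ∀ t ≤ t₁, barrier T θ t₁ ≤ barrier T θ t := fun t ht => h.barrier_le h1 hb.le ht
  refine tendsto_order.2 ⟨fun a ha => ?_,
    fun a ha => .of_forall fun t => (Real.sin_le_one _).trans_lt ha⟩
  by_contra hcon
  have hle : ∀ t ≤ t₁, barrier T θ t ≤ a := by
    intro t ht
    by_contra! hlt
    refine hcon ((eventually_le_atBot t).mono fun s hs => ?_)
    have h2 := h.barrier_le h1 (hb.le.trans (hge t ht)) hs
    linarith [h.barrier_le_sin h1 s]
  have ha0 : 0 < a := hb.trans_le (hle t₁ le_rfl)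
  -- Far in the past `sin θ ≤ a + u / 3 ≤ (1 + a) / 2`, so `cos² θ ≥ δ`; with `1 - T > 1/2` the
  -- barrier then grows backwards at a uniform rate, although it is at most one.
  have hev : ∀ᶠ t in atBot, odds (T t) < 3 * ((1 - a) / 2) ∧ T t < 1 / 2 ∧ t ≤ t₁ :=
    ((h.tendsto_odds h1).eventually_lt_const (by linarith)).and
      (((h.tendsto_zero h1).eventually_lt_const (by norm_num)).and (eventually_le_atBot t₁))
  obtain ⟨t₂, ht₂⟩ := eventually_atBot.1 hev
  set δ := 1 - ((1 + a) / 2) ^ 2 with hδ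
  have hδ0 : 0 < δ := by nlinarith
  refine false_of_deriv_le_of_le (f := barrier T θ) (t₀ := t₂) (B := 1)
    (ε := 3 / 2 * δ * barrier T θ t₁) (by positivity)
    (h.hasDerivAt_barrier h1) (fun t ht => (h.deriv_barrier_le h1 t).trans ?_)
    fun t _ => (h.barrier_le_sin h1 t).trans (Real.sin_le_one _)
  obtain ⟨hu, hT, ht₁⟩ := ht₂ t ht
  have hbt := hge t ht₁
  have hs0 : 0 ≤ Real.sin (θ t) := by linarith [h.barrier_le_sin h1 t]
  have hs1 : Real.sin (θ t) ≤ (1 + a) / 2 := by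
    have := hle t ht₁
    rw [barrier] at this
    linarith
  have hc : δ ≤ Real.cos (θ t) ^ 2 := by
    have := Real.sin_sq_add_cos_sq (θ t)
    nlinarith
  have h4 : 1 / 2 * δ ≤ (1 - T t) * Real.cos (θ t) ^ 2 :=
    mul_le_mul (by linarith) hc hδ0.le (by linarith)
  have h5 : 1 / 2 * δ * barrier T θ t₁ ≤ (1 - T t) * Real.cos (θ t) ^ 2 * barrier T θ t :=
    mul_le_mul h4 hbt hb.le (by nlinarith)
  linarith

theorem IsLift.tendsto_MPlus_of_barrier (h : IsLift T θ) (h1 : ∀ t, T t < 1) {t₁ : ℝ}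
    (hb : 0 < barrier T θ t₁) : Tendsto (project T θ) atBot (𝓝 MPlus) := by
  refine tendsto_MPlus (h.tendsto_zero h1) ?_
  simpa only [project, Real.Angle.sin_coe] using h.tendsto_sin_one h1 hb

end Sources

/-! ### The half-turn. -/

section Symmetry

theorem continuous_halfTurn : Continuous halfTurn :=
  continuous_fst.prodMk (continuous_snd.add continuous_const)

theorem halfTurn_halfTurn (p : Cyl) : halfTurn (halfTurn p) = p := by
  simp [halfTurn, add_assoc]

theorem halfTurn_MPlus : halfTurn MPlus = MMinus := by
  simp only [halfTurn, MPlus, MMinus, Prod.mk.injEq, true_and]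
  rw [← Real.Angle.coe_add, Real.Angle.angle_eq_iff_two_pi_dvd_sub]
  exact ⟨1, by push_cast; ring⟩

theorem halfTurn_MMinus : halfTurn MMinus = MPlus := by
  rw [← halfTurn_MPlus, halfTurn_halfTurn]

theorem halfTurn_dSPlus : halfTurn dSPlus = dSMinus := by
  simp [halfTurn, dSPlus, dSMinus]

theorem halfTurn_dSMinus : halfTurn dSMinus = dSPlus := by
  rw [← halfTurn_dSPlus, halfTurn_halfTurn]

theorem tendsto_halfTurn_iff {c : ℝ → Cyl} {l : Filter ℝ} {p : Cyl} :
    Tendsto (fun t => halfTurn (c t)) l (𝓝 (halfTurn p)) ↔ Tendsto c l (𝓝 p) := by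
  refine ⟨fun h => ?_, fun h => (continuous_halfTurn.tendsto p).comp h⟩
  have := (continuous_halfTurn.tendsto (halfTurn p)).comp h
  simpa [Function.comp_def, halfTurn_halfTurn] using this

theorem project_add_pi (T θ : ℝ → ℝ) :
    project T (fun t => θ t + Real.pi) = fun t => halfTurn (project T θ t) := by
  funext t
  simp [project, halfTurn]

theorem MPlus_ne_dSPlus : MPlus ≠ dSPlus := fun h => by
  simpa [MPlus, dSPlus] using congrArg (fun p : Cyl => p.2.sin) h

theorem MMinus_ne_dSPlus : MMinus ≠ dSPlus := fun h => by
  simpa [MMinus, dSPlus, neg_div] using congrArg (fun p : Cyl => p.2.sin) h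

theorem dSPlus_ne_dSMinus : dSPlus ≠ dSMinus := fun h => by
  have := congrArg (fun p : Cyl => p.2.cos) h
  simp [dSMinus, dSPlus] at this
  linarith

end Symmetry

/-! ### The four possible origins of an orbit. -/

section AlphaLimits

variable {T θ : ℝ → ℝ}

theorem barrier_add_pi (T θ : ℝ → ℝ) (t : ℝ) :
    barrier T (fun t => θ t + Real.pi) t = -Real.sin (θ t) - odds (T t) / 3 := by
  simp [barrier]

theorem IsLift.tendsto_MMinus_of_barrier (h : IsLift T θ) (h1 : ∀ t, T t < 1) {t₁ : ℝ}
    (hb : 0 < barrier T (fun t => θ t + Real.pi) t₁) :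
    Tendsto (project T θ) atBot (𝓝 MMinus) := by
  have := h.add_pi.tendsto_MPlus_of_barrier h1 hb
  rwa [project_add_pi, ← halfTurn_MMinus, tendsto_halfTurn_iff] at this

theorem IsLift.tendsto_M_or_abs_sin_le (h : IsLift T θ) (h1 : ∀ t, T t < 1) :
    Tendsto (project T θ) atBot (𝓝 MPlus) ∨ Tendsto (project T θ) atBot (𝓝 MMinus) ∨
      ∀ t, |Real.sin (θ t)| ≤ odds (T t) / 3 := by
  by_cases hp : ∃ t, 0 < barrier T θ t
  · obtain ⟨t, ht⟩ := hp
    exact Or.inl (h.tendsto_MPlus_of_barrier h1 ht)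
  by_cases hm : ∃ t, 0 < barrier T (fun t => θ t + Real.pi) t
  · obtain ⟨t, ht⟩ := hm
    exact Or.inr (Or.inl (h.tendsto_MMinus_of_barrier h1 ht))
  push Not at hp hm
  refine Or.inr (Or.inr fun t => ?_)
  have e1 := hp t
  have e2 := hm t
  rw [barrier_add_pi] at e2
  rw [barrier] at e1
  exact abs_le.2 ⟨by linarith, by linarith⟩

theorem IsLift.tendsto_sin_zero (h : IsLift T θ) (h1 : ∀ t, T t < 1) {t₁ : ℝ}
    (hs : ∀ t ≤ t₁, |Real.sin (θ t)| ≤ odds (T t) / 3) :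
    Tendsto (fun t => Real.sin (θ t)) atBot (𝓝 0) := by
  have := (h.tendsto_odds h1).div_const 3
  rw [zero_div] at this
  exact squeeze_zero_norm' ((eventually_le_atBot t₁).mono hs) this

theorem cos_ne_zero_of_abs_sin_le {x u : ℝ} (hu : u ≤ 1) (hs : |Real.sin x| ≤ u / 3) :
    Real.cos x ≠ 0 := fun hc => by
  have h1 := Real.sin_sq_add_cos_sq x
  rw [hc, ← sq_abs (Real.sin x)] at h1
  have := abs_nonneg (Real.sin x)
  nlinarith

theorem IsLift.odds_le_one (h : IsLift T θ) {t₁ : ℝ} (hT : T t₁ ≤ 1 / 2) {t : ℝ} (ht : t ≤ t₁) :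
    odds (T t) ≤ 1 := by
  have := h.monotone ht
  rw [odds, div_le_one (by linarith)]
  linarith

/-- Since `T ≤ 1/2` gives `u ≤ 1`, hence `|sin θ| ≤ 1/3`, the cosine cannot vanish and keeps its
sign; so `cos θ = √(1 - sin² θ) → 1`. -/
theorem IsLift.tendsto_dSPlus_of_abs_sin_le (h : IsLift T θ) (h1 : ∀ t, T t < 1) {t₁ : ℝ}
    (hT : T t₁ ≤ 1 / 2) (hs : ∀ t ≤ t₁, |Real.sin (θ t)| ≤ odds (T t) / 3)
    (hc : 0 < Real.cos (θ t₁)) : Tendsto (project T θ) atBot (𝓝 dSPlus) := by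
  have hne : ∀ t ≤ t₁, Real.cos (θ t) ≠ 0 := fun t ht =>
    cos_ne_zero_of_abs_sin_le (h.odds_le_one hT ht) (hs t ht)
  have hcos : Continuous fun t => Real.cos (θ t) := Real.continuous_cos.comp h.continuous_θ
  have hpos : ∀ t ≤ t₁, 0 < Real.cos (θ t) := by
    intro t ht
    by_contra! hle
    obtain ⟨r, hr, hr0⟩ := intermediate_value_Icc ht hcos.continuousOn ⟨hle, hc.le⟩
    exact hne r hr.2 hr0
  refine tendsto_dSPlus (h.tendsto_zero h1) ?_
  simp only [project, Real.Angle.cos_coe]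
  have hlim := (((h.tendsto_sin_zero h1 hs).pow 2).const_sub 1).sqrt
  simp only [ne_eq, OfNat.ofNat_ne_zero, not_false_eq_true, zero_pow, sub_zero,
    Real.sqrt_one] at hlim
  refine hlim.congr' ((eventually_le_atBot t₁).mono fun t ht => ?_)
  rw [Real.sqrt_eq_iff_mul_self_eq]
  · nlinarith [Real.sin_sq_add_cos_sq (θ t)]
  · nlinarith [Real.sin_sq_le_one (θ t)]
  · exact (hpos t ht).le

theorem IsLift.tendsto_dS_of_abs_sin_le (h : IsLift T θ) (h1 : ∀ t, T t < 1)
    (hs : ∀ t, |Real.sin (θ t)| ≤ odds (T t) / 3) :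
    Tendsto (project T θ) atBot (𝓝 dSPlus) ∨ Tendsto (project T θ) atBot (𝓝 dSMinus) := by
  obtain ⟨t₁, ht₁⟩ := ((h.tendsto_zero h1).eventually_lt_const (by norm_num : (0 : ℝ) < 1 / 2)).exists
  rcases lt_or_gt_of_ne (cos_ne_zero_of_abs_sin_le (h.odds_le_one ht₁.le le_rfl) (hs t₁)) with hc | hc
  · right
    have := h.add_pi.tendsto_dSPlus_of_abs_sin_le h1 ht₁.le (fun t _ => by simpa using hs t)
      (by simpa using hc)
    rwa [project_add_pi, ← halfTurn_dSMinus, tendsto_halfTurn_iff] at this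
  · left
    exact h.tendsto_dSPlus_of_abs_sin_le h1 ht₁.le (fun t _ => hs t) hc

end AlphaLimits

/-! ### Existence of the attractor solution by shooting. -/

section AttractorExistence

theorem continuous_lift_backward {T θ : ℝ → ℝ → ℝ} (h : ∀ x, IsLift (T x) (θ x)) {a : ℝ}
    (hT0 : ∀ x, T x 0 = a) (hθ0 : ∀ x, θ x 0 = x) {t : ℝ} (ht : t ≤ 0) :
    Continuous fun x => (T x t, θ x t) := by
  refine (LipschitzWith.of_dist_le_mul
    (K := (Real.exp ((15 : NNReal) * -t)).toNNReal) fun x y => ?_).continuous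
  have := dist_le_of_integralCurve_backward lipschitzWith_clampedField
    (h x).hasDerivAt_clampedField (h y).hasDerivAt_clampedField ht
  refine this.trans (le_of_eq ?_)
  rw [hT0, hT0, hθ0, hθ0, mul_comm, Real.coe_toNNReal _ (Real.exp_pos _).le]
  simp [Prod.dist_eq]

theorem exists_lift_tendsto_dSPlus :
    ∃ T θ, IsLift T θ ∧ (∀ t, 0 < T t) ∧ (∀ t, T t < 1) ∧
      Tendsto (project T θ) atBot (𝓝 dSPlus) := by
  choose T θ h hT0 hθ0 using fun x : ℝ => exists_isLift (1 / 2) x (by norm_num) (by norm_num)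
  have hlt : ∀ x t, T x t < 1 := fun x => (h x).lt_one (t₀ := 0) (by rw [hT0]; norm_num)
  have hpos : ∀ x t, 0 < T x t := fun x => (h x).pos (t₀ := 0) (by rw [hT0]; norm_num)
  have hodds : ∀ x, odds (T x 0) = 1 := fun x => by rw [hT0, odds]; norm_num
  have hcont : ∀ t ≤ 0, Continuous fun x => odds (T x t) := fun t ht =>
    continuous_iff_continuousAt.2 fun x => (continuousAt_odds (hlt x t)).comp
      (f := fun x => T x t) (continuous_lift_backward h hT0 hθ0 ht).fst.continuousAt
  have hsin : ∀ t ≤ 0, Continuous fun x => Real.sin (θ x t) := fun t ht =>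
    Real.continuous_sin.comp (continuous_lift_backward h hT0 hθ0 ht).snd
  -- Initial angles on `T = 1/2` whose past crosses the upper, respectively lower, barrier; both
  -- sets are open by continuous dependence.
  set A : Set ℝ := {x | ∃ t ≤ 0, 0 < barrier (T x) (θ x) t} with hA
  set B : Set ℝ := {x | ∃ t ≤ 0, 0 < barrier (T x) (fun t => θ x t + Real.pi) t} with hB
  have hAo : IsOpen A := by
    have : A = ⋃ t ∈ Iic (0 : ℝ), {x | 0 < barrier (T x) (θ x) t} := by
      ext x; simp [hA]
    rw [this]
    refine isOpen_biUnion fun t ht => isOpen_lt continuous_const ?_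
    exact (hsin t ht).sub ((hcont t ht).div_const 3)
  have hBo : IsOpen B := by
    have : B = ⋃ t ∈ Iic (0 : ℝ), {x | 0 < barrier (T x) (fun t => θ x t + Real.pi) t} := by
      ext x; simp [hB]
    rw [this]
    refine isOpen_biUnion fun t ht => isOpen_lt continuous_const ?_
    simp only [barrier_add_pi]
    exact (hsin t ht).neg.sub ((hcont t ht).div_const 3)
  -- Positive barriers persist into the past, so at the earlier of the two times both `sin θ` and
  -- `-sin θ` would exceed `u / 3 > 0`.
  have hdisj : ¬ (Icc (-(Real.pi / 2)) (Real.pi / 2) ∩ (A ∩ B)).Nonempty := by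
    rintro ⟨x, -, ⟨t, -, ht⟩, ⟨r, -, hr⟩⟩
    have e1 := (h x).barrier_le (hlt x) ht.le (min_le_left t r)
    have e2 := (h x).add_pi.barrier_le (hlt x) hr.le (min_le_right t r)
    rw [barrier_add_pi _ _ (min t r)] at e2
    rw [barrier.eq_def _ _ (min t r)] at e1
    linarith [odds_pos (hpos x (min t r)) (hlt x (min t r))]
  have hle : -(Real.pi / 2) ≤ Real.pi / 2 := by linarith [Real.pi_pos]
  have hncov : ¬ Icc (-(Real.pi / 2)) (Real.pi / 2) ⊆ A ∪ B := fun hsub =>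
    hdisj (isPreconnected_Icc A B hAo hBo hsub
      ⟨Real.pi / 2, ⟨hle, le_rfl⟩, 0, le_rfl, by
        rw [barrier, hodds, hθ0, Real.sin_pi_div_two]; norm_num⟩
      ⟨-(Real.pi / 2), ⟨le_rfl, hle⟩, 0, le_rfl, by
        rw [barrier_add_pi, hodds, hθ0, Real.sin_neg, Real.sin_pi_div_two]; norm_num⟩)
  obtain ⟨x, hx, hxAB⟩ := not_subset.1 hncov
  have hs : ∀ t ≤ 0, |Real.sin (θ x t)| ≤ odds (T x t) / 3 := by
    intro t ht
    have e1 : barrier (T x) (θ x) t ≤ 0 := not_lt.1 fun hlt' => hxAB (Or.inl ⟨t, ht, hlt'⟩)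
    have e2 : barrier (T x) (fun t => θ x t + Real.pi) t ≤ 0 :=
      not_lt.1 fun hlt' => hxAB (Or.inr ⟨t, ht, hlt'⟩)
    rw [barrier_add_pi] at e2
    rw [barrier] at e1
    exact abs_le.2 ⟨by linarith, by linarith⟩
  refine ⟨T x, θ x, h x, hpos x, hlt x,
    (h x).tendsto_dSPlus_of_abs_sin_le (hlt x) (hT0 x).le hs ?_⟩
  -- The arc `[-π/2, π/2]` makes the initial cosine nonnegative, which selects `dSPlus` rather than
  -- `dSMinus`.
  refine lt_of_le_of_ne ?_ (cos_ne_zero_of_abs_sin_le (hodds x).le (hs 0 le_rfl)).symm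
  rw [hθ0]
  exact Real.cos_nonneg_of_mem_Icc hx

end AttractorExistence

/-! ### Uniqueness of the attractor solution. -/

section AttractorUniqueness

variable {T θ : ℝ → ℝ}

theorem IsLift.abs_sin_le_of_tendsto_dSPlus (h : IsLift T θ) (h1 : ∀ t, T t < 1)
    (hlim : Tendsto (project T θ) atBot (𝓝 dSPlus)) (t : ℝ) :
    |Real.sin (θ t)| ≤ odds (T t) / 3 := by
  rcases h.tendsto_M_or_abs_sin_le h1 with hM | hM | hM
  · exact absurd (tendsto_nhds_unique hM hlim) MPlus_ne_dSPlus
  · exact absurd (tendsto_nhds_unique hM hlim) MMinus_ne_dSPlus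
  · exact hM t

theorem tendsto_cos_of_tendsto_dSPlus (hlim : Tendsto (project T θ) atBot (𝓝 dSPlus)) :
    Tendsto (fun t => Real.cos (θ t)) atBot (𝓝 1) := by
  have := ((Real.Angle.continuous_cos.comp continuous_snd).tendsto dSPlus).comp hlim
  simpa [Function.comp_def, project, dSPlus] using this

/-- A solution emanating from the de Sitter point approaches it through negative angles. -/
theorem IsLift.sin_neg_of_tendsto_dSPlus (h : IsLift T θ) (h0 : ∀ t, 0 < T t)
    (h1 : ∀ t, T t < 1) (hlim : Tendsto (project T θ) atBot (𝓝 dSPlus)) {t₁ : ℝ}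
    (hc : ∀ t ≤ t₁, 0 < Real.cos (θ t)) : Real.sin (θ t₁) < 0 := by
  by_contra! hs
  have hcT := h.continuous_T
  have hcθ := h.continuous_θ
  have hk : ∀ t, 0 < 1 - T t := fun t => by linarith [h1 t]
  have hkcu : ∀ t ≤ t₁, 0 < (1 - T t) * Real.cos (θ t) * odds (T t) := fun t ht =>
    mul_pos (mul_pos (hk t) (hc t ht)) (odds_pos (h0 t) (h1 t))
  -- While `cos θ > 0`, a nonnegative `sin θ` stays so backwards and strictly decreases in time; its
  -- past values then stay above a positive number, against `sin θ → 0`.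
  have hge : ∀ t ≤ t₁, 0 ≤ Real.sin (θ t) := fun t ht => hs.trans <|
    le_of_deriv_le_neg_mul (a := fun t => 3 * (1 - T t) * Real.cos (θ t) ^ 2) (by fun_prop)
      (fun t => by have := (hk t).le; positivity) (h.hasDerivAt_sin h1)
      (fun t ht => by linarith [hkcu t ht.le]) hs ht
  have hanti : StrictAntiOn (fun t => Real.sin (θ t)) (Iic t₁) := by
    refine strictAntiOn_of_deriv_neg (convex_Iic t₁)
      (Real.continuous_sin.comp hcθ).continuousOn fun t ht => ?_
    have ht' : t ∈ Iic t₁ := interior_subset ht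
    rw [mem_Iic] at ht'
    rw [(h.hasDerivAt_sin h1 t).deriv]
    have h2 : 0 ≤ (1 - T t) * Real.sin (θ t) * Real.cos (θ t) ^ 2 :=
      mul_nonneg (mul_nonneg (hk t).le (hge t ht')) (sq_nonneg _)
    linarith [hkcu t ht']
  have hpos : 0 < Real.sin (θ (t₁ - 1)) :=
    hs.trans_lt (hanti (by simp) self_mem_Iic (by linarith))
  have hzero := h.tendsto_sin_zero h1 (t₁ := t₁)
    fun t _ => h.abs_sin_le_of_tendsto_dSPlus h1 hlim t
  have := ge_of_tendsto hzero ((eventually_le_atBot (t₁ - 1)).mono fun t ht =>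
    hanti.antitoneOn (a := t) (b := t₁ - 1) (mem_Iic.2 (by linarith)) (by simp) ht)
  linarith

theorem IsLift.hasDerivAt_cos_div_odds (h : IsLift T θ) (h0 : ∀ t, 0 < T t)
    (h1 : ∀ t, T t < 1) (t : ℝ) :
    HasDerivAt (fun t => Real.cos (θ t) / odds (T t)) ((1 - T t) * Real.sin (θ t)) t := by
  have hu := (odds_pos (h0 t) (h1 t)).ne'
  refine ((h.hasDerivAt_cos h1 t).div (h.hasDerivAt_odds h1 t) hu).congr_deriv ?_
  field_simp
  ring

theorem IsLift.hasDerivAt_sin_div_odds (h : IsLift T θ) (h0 : ∀ t, 0 < T t)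
    (h1 : ∀ t, T t < 1) (t : ℝ) :
    HasDerivAt (fun t => Real.sin (θ t) / odds (T t))
      ((1 - T t) * (-Real.cos (θ t) - 3 * (Real.sin (θ t) / odds (T t)))) t := by
  have hu := (odds_pos (h0 t) (h1 t)).ne'
  refine ((h.hasDerivAt_sin h1 t).div (h.hasDerivAt_odds h1 t) hu).congr_deriv ?_
  have := Real.sin_sq_add_cos_sq (θ t)
  field_simp
  linear_combination (-3 * Real.sin (θ t) * (1 - T t)) * this

/-- A strictly antitone differentiable function on a left half-line that tends to `+∞` at `-∞` has
a differentiable inverse. -/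
theorem exists_inverse_of_deriv_neg {f f' : ℝ → ℝ} {t₀ : ℝ}
    (hf : ∀ t, HasDerivAt f (f' t) t) (hf' : ∀ t ≤ t₀, f' t < 0) (hlim : Tendsto f atBot atTop) :
    ∃ g : ℝ → ℝ, ∀ y > f t₀, g y ≤ t₀ ∧ f (g y) = y ∧ HasDerivAt g (f' (g y))⁻¹ y := by
  have hcont : Continuous f := continuous_iff_continuousAt.2 fun t => (hf t).continuousAt
  have hanti : StrictAntiOn f (Iic t₀) :=
    strictAntiOn_of_deriv_neg (convex_Iic t₀) hcont.continuousOn fun t ht => by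
      have ht' : t ∈ Iic t₀ := interior_subset ht
      rw [(hf t).deriv]; exact hf' t ht'
  have hex : ∀ y, f t₀ < y → ∃ t, t ≤ t₀ ∧ f t = y := by
    intro y hy
    obtain ⟨t, ht, hty⟩ := ((eventually_le_atBot t₀).and (hlim.eventually_ge_atTop y)).exists
    obtain ⟨r, hr, hry⟩ := intermediate_value_Icc' ht hcont.continuousOn ⟨hy.le, hty⟩
    exact ⟨r, hr.2, hry⟩
  choose! g hg hfg using hex
  refine ⟨g, fun y hy => ⟨hg y hy, hfg y hy, ?_⟩⟩
  have hev : ∀ᶠ z in 𝓝 y, f t₀ < z := lt_mem_nhds hy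
  have hlt : g y < t₀ := lt_of_le_of_ne (hg y hy) fun e => by
    have := hfg y hy
    rw [e] at this
    exact hy.ne this
  refine HasDerivAt.of_local_left_inverse ?_ (hf (g y)) (hf' _ (hg y hy)).ne
    (hev.mono fun z hz => hfg z hz)
  refine tendsto_order.2 ⟨fun a ha => ?_, fun b hb => ?_⟩
  · have hya : y < f a := by
      have := hanti (mem_Iic.2 (ha.le.trans hlt.le)) (mem_Iic.2 hlt.le) ha
      rwa [hfg y hy] at this
    filter_upwards [hev, gt_mem_nhds hya] with z hz hza
    by_contra! hle
    have := hanti.antitoneOn (mem_Iic.2 (hg z hz)) (mem_Iic.2 (ha.le.trans hlt.le)) hle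
    rw [hfg z hz] at this
    linarith
  · have hb' : g y < min b t₀ := lt_min hb hlt
    have hyb : f (min b t₀) < y := by
      have := hanti (mem_Iic.2 hlt.le) (mem_Iic.2 (min_le_right b t₀)) hb'
      rwa [hfg y hy] at this
    filter_upwards [hev, lt_mem_nhds hyb] with z hz hzb
    by_contra! hle
    have := hanti.antitoneOn (mem_Iic.2 (min_le_right b t₀)) (mem_Iic.2 (hg z hz))
      ((min_le_left _ _).trans hle)
    rw [hfg z hz] at this
    linarith

/-- Dividing the two derivatives cancels the time factor `k = 1 - T`, and `cos² + sin² = 1` turns `1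
/ u` into `√(y² + p²)`, so the equation closes in `(y, p)`. -/
theorem graph_deriv_eq {c s u k y : ℝ} (hu : 0 < u) (hs : s ≠ 0) (hk : k ≠ 0) (hy : c / u = y)
    (hcs : c ^ 2 + s ^ 2 = 1) : k * (-c - 3 * (s / u)) * (k * s)⁻¹ =
      -y / (s / u) - 3 * Real.sqrt (y ^ 2 + (s / u) ^ 2) := by
  have hsq : Real.sqrt (y ^ 2 + (s / u) ^ 2) = 1 / u := by
    rw [Real.sqrt_eq_iff_mul_self_eq (by positivity) (by positivity), ← hy, div_pow, div_pow,
      ← add_div, hcs]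
    field_simp
  rw [hsq, ← hy]
  field_simp

/-- In the variables `(φ, p) = (cos θ, sin θ) (1 - T) / T` a solution emanating from the de Sitter
point is, near this point, the graph of a bounded solution of a scalar equation. -/
theorem IsLift.exists_graph (h : IsLift T θ) (h0 : ∀ t, 0 < T t) (h1 : ∀ t, T t < 1)
    (hlim : Tendsto (project T θ) atBot (𝓝 dSPlus)) :
    ∃ (Y : ℝ) (P : ℝ → ℝ), ∀ y > Y, -(1 / 3) ≤ P y ∧ P y < 0 ∧
      HasDerivAt P (-y / P y - 3 * Real.sqrt (y ^ 2 + P y ^ 2)) y ∧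
      ∃ t, Real.cos (θ t) / odds (T t) = y ∧ Real.sin (θ t) / odds (T t) = P y := by
  have hu : ∀ t, 0 < odds (T t) := fun t => odds_pos (h0 t) (h1 t)
  have hcos := tendsto_cos_of_tendsto_dSPlus hlim
  obtain ⟨t₀, ht₀⟩ := eventually_atBot.1 (hcos.eventually_const_lt zero_lt_one)
  have hsin : ∀ t ≤ t₀, Real.sin (θ t) < 0 := fun t ht =>
    h.sin_neg_of_tendsto_dSPlus h0 h1 hlim fun r hr => ht₀ r (hr.trans ht)
  have hinv : Tendsto (fun t => (odds (T t))⁻¹) atBot atTop :=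
    (tendsto_nhdsWithin_iff.2 ⟨h.tendsto_odds h1, .of_forall hu⟩).inv_tendsto_nhdsGT_zero
  have hφ : Tendsto (fun t => Real.cos (θ t) / odds (T t)) atBot atTop :=
    hcos.pos_mul_atTop zero_lt_one hinv
  obtain ⟨g, hg⟩ := exists_inverse_of_deriv_neg (t₀ := t₀) (h.hasDerivAt_cos_div_odds h0 h1)
    (fun t ht => mul_neg_of_pos_of_neg (by linarith [h1 t]) (hsin t ht)) hφ
  refine ⟨Real.cos (θ t₀) / odds (T t₀), fun y => Real.sin (θ (g y)) / odds (T (g y)), fun y hy => ?_⟩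
  obtain ⟨hgt, hgy, hgd⟩ := hg y hy
  have hs := hsin (g y) hgt
  have hu' := hu (g y)
  refine ⟨?_, div_neg_of_neg_of_pos hs hu', ?_, g y, hgy, rfl⟩
  -- The bound `-1/3` is the barrier estimate `|sin θ| ≤ u / 3` divided by `u`.
  · rw [le_div_iff₀ hu']
    linarith [(abs_le.1 (h.abs_sin_le_of_tendsto_dSPlus h1 hlim (g y))).1]
  · refine ((h.hasDerivAt_sin_div_odds h0 h1 (g y)).comp y hgd).congr_deriv ?_
    exact graph_deriv_eq hu' hs.ne (by linarith [h1 (g y)]) hgy (Real.cos_sq_add_sin_sq _)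

/-- The scalar equation `dp/dφ = -φ / p - 3 √(φ² + p²)` has a right-hand side that is increasing in
`p < 0`. -/
theorem graph_deriv_sub_mul_le {y p q : ℝ} (hy : 1 ≤ y) (hp : -(1 / 3) ≤ p) (hp' : p < 0)
    (hq : -(1 / 3) ≤ q) (hq' : q < 0) :
    9 * (p - q) ^ 2 ≤ (p - q) * ((-y / p - 3 * Real.sqrt (y ^ 2 + p ^ 2)) -
      (-y / q - 3 * Real.sqrt (y ^ 2 + q ^ 2))) := by
  have hpq : 0 < p * q := mul_pos_of_neg_of_neg hp' hq'
  have hpq' : p * q ≤ 1 / 9 := by nlinarith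
  have e1 : (p - q) * (-y / p + y / q) = y / (p * q) * (p - q) ^ 2 := by
    have := hp'.ne
    have := hq'.ne
    field_simp
    ring
  -- The rate `9` comes from `y ≥ 1` and `p q ≤ 1/9`. The square-root terms only help, since `√(y² +
  -- p²)` decreases in `p < 0`.
  have e2 : 9 ≤ y / (p * q) := by
    rw [le_div_iff₀ hpq]
    nlinarith
  have e3 : 0 ≤ (p - q) * (Real.sqrt (y ^ 2 + q ^ 2) - Real.sqrt (y ^ 2 + p ^ 2)) := by
    rcases le_total p q with hle | hle
    · refine mul_nonneg_of_nonpos_of_nonpos (by linarith)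
        (sub_nonpos.2 (Real.sqrt_le_sqrt (by nlinarith)))
    · exact mul_nonneg (by linarith) (sub_nonneg.2 (Real.sqrt_le_sqrt (by nlinarith)))
  have e4 := mul_le_mul_of_nonneg_right e2 (sq_nonneg (p - q))
  rw [neg_div, neg_div] at *
  linarith

/-- If the graphs differ at `y₀`, then `(P - Q)²` has derivative at least `18 (P y₀ - Q y₀)² > 0`
from there on, although both functions stay in `[-1/3, 0)`. -/
theorem graph_unique {P Q : ℝ → ℝ} {Y : ℝ}
    (hP : ∀ y > Y, -(1 / 3) ≤ P y ∧ P y < 0 ∧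
      HasDerivAt P (-y / P y - 3 * Real.sqrt (y ^ 2 + P y ^ 2)) y)
    (hQ : ∀ y > Y, -(1 / 3) ≤ Q y ∧ Q y < 0 ∧
      HasDerivAt Q (-y / Q y - 3 * Real.sqrt (y ^ 2 + Q y ^ 2)) y)
    {y₀ : ℝ} (hY : Y < y₀) (hy₀ : 1 ≤ y₀) : P y₀ = Q y₀ := by
  by_contra hne
  have hd : ∀ y ≥ y₀, HasDerivAt (fun y => (P y - Q y) ^ 2)
      (2 * ((P y - Q y) * ((-y / P y - 3 * Real.sqrt (y ^ 2 + P y ^ 2)) -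
        (-y / Q y - 3 * Real.sqrt (y ^ 2 + Q y ^ 2))))) y := by
    intro y hy
    refine (((hP y (hY.trans_le hy)).2.2.sub (hQ y (hY.trans_le hy)).2.2).pow 2).congr_deriv ?_
    push_cast
    simp only [Pi.sub_apply]
    ring
  have hge : ∀ y ≥ y₀, 18 * (P y - Q y) ^ 2 ≤
      2 * ((P y - Q y) * ((-y / P y - 3 * Real.sqrt (y ^ 2 + P y ^ 2)) -
        (-y / Q y - 3 * Real.sqrt (y ^ 2 + Q y ^ 2)))) := by
    intro y hy
    obtain ⟨a1, a2, -⟩ := hP y (hY.trans_le hy)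
    obtain ⟨b1, b2, -⟩ := hQ y (hY.trans_le hy)
    linarith [graph_deriv_sub_mul_le (hy₀.trans hy) a1 a2 b1 b2]
  have hmono : MonotoneOn (fun y => (P y - Q y) ^ 2) (Ici y₀) := by
    refine monotoneOn_of_deriv_nonneg (convex_Ici y₀)
      (fun y hy => (hd y hy).continuousAt.continuousWithinAt)
      (fun y hy => (hd y (interior_subset hy)).differentiableAt.differentiableWithinAt)
      fun y hy => ?_
    rw [(hd y (interior_subset hy)).deriv]
    exact le_trans (by positivity) (hge y (interior_subset hy))
  have hpos : 0 < (P y₀ - Q y₀) ^ 2 := by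
    have := sub_ne_zero.2 hne
    positivity
  refine false_of_deriv_ge_of_le (ε := 18 * (P y₀ - Q y₀) ^ 2) (B := 1) (by positivity) hd
    (fun y hy => le_trans ?_ (hge y hy)) fun y hy => ?_
  · exact mul_le_mul_of_nonneg_left (hmono self_mem_Ici hy hy) (by norm_num)
  · obtain ⟨a1, a2, -⟩ := hP y (hY.trans_le hy)
    obtain ⟨b1, b2, -⟩ := hQ y (hY.trans_le hy)
    show (P y - Q y) ^ 2 ≤ 1
    nlinarith

theorem odds_injOn {x y : ℝ} (hx : x < 1) (hy : y < 1) (h : odds x = odds y) : x = y := by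
  have hx' : 1 - x ≠ 0 := by linarith
  have hy' : 1 - y ≠ 0 := by linarith
  rw [odds, odds, div_eq_div_iff hx' hy'] at h
  linarith

/-- At most one orbit in the interior emanates from the de Sitter point. -/
theorem range_eq_of_tendsto_dSPlus {T' θ' : ℝ → ℝ} (h : IsLift T θ) (h0 : ∀ t, 0 < T t)
    (h1 : ∀ t, T t < 1) (hlim : Tendsto (project T θ) atBot (𝓝 dSPlus))
    (h' : IsLift T' θ') (h0' : ∀ t, 0 < T' t) (h1' : ∀ t, T' t < 1)
    (hlim' : Tendsto (project T' θ') atBot (𝓝 dSPlus)) :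
    range (project T θ) = range (project T' θ') := by
  obtain ⟨Y, P, hP⟩ := h.exists_graph h0 h1 hlim
  obtain ⟨Z, Q, hQ⟩ := h'.exists_graph h0' h1' hlim'
  set y := max 1 (max Y Z + 1)
  have hyY : max Y Z < y := lt_of_lt_of_le (by linarith) (le_max_right _ _)
  have hPQ : P y = Q y := graph_unique (Y := max Y Z)
    (fun z hz => have := hP z ((le_max_left _ _).trans_lt hz); ⟨this.1, this.2.1, this.2.2.1⟩)
    (fun z hz => have := hQ z ((le_max_right _ _).trans_lt hz); ⟨this.1, this.2.1, this.2.2.1⟩)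
    hyY (le_max_left _ _)
  obtain ⟨-, -, -, s, hcs, hss⟩ := hP y ((le_max_left _ _).trans_lt hyY)
  obtain ⟨-, -, -, t, hct, hst⟩ := hQ y ((le_max_right _ _).trans_lt hyY)
  have hc : Real.cos (θ s) / odds (T s) = Real.cos (θ' t) / odds (T' t) := hcs.trans hct.symm
  have hs : Real.sin (θ s) / odds (T s) = Real.sin (θ' t) / odds (T' t) := by
    rw [hss, hst, hPQ]
  have hu := odds_pos (h0 s) (h1 s)
  have hu' := odds_pos (h0' t) (h1' t)
  -- The Euclidean norm of `(cos, sin) / u` is `1 / u`, so equal graph points force equal `T` and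
  -- then equal angles: the two orbits meet.
  have key : ∀ x u : ℝ, (Real.cos x / u) ^ 2 + (Real.sin x / u) ^ 2 = (u⁻¹) ^ 2 := by
    intro x u
    have := Real.cos_sq_add_sin_sq x
    rw [div_eq_mul_inv, div_eq_mul_inv]
    linear_combination (u⁻¹) ^ 2 * this
  have hodds : odds (T s) = odds (T' t) := by
    have e : ((odds (T s))⁻¹) ^ 2 = ((odds (T' t))⁻¹) ^ 2 := by
      rw [← key (θ s), ← key (θ' t), hc, hs]
    exact inv_injective ((pow_left_inj₀ (by positivity) (by positivity) two_ne_zero).1 e)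
  rw [hodds, div_left_inj' hu'.ne'] at hc hs
  refine range_eq_of_mem_inter h.isSolution h'.isSolution (s := s) (t := t) ?_
  rw [project, project, odds_injOn (h1 s) (h1' t) hodds, Real.Angle.cos_sin_inj hc hs]

end AttractorUniqueness

/-! ### Future limits in the interior and on the boundary circles. -/

section ForwardLimits

variable {T θ : ℝ → ℝ}

/-- Once `T > 9/10`, `θ' ≤ -9/10 + 3/10 < -1/2`, so the lifted angle decreases without bound and
crosses every representative `x - 2πn` lying below it. -/
theorem IsLift.frequently_angle_eq (h : IsLift T θ) (hT : Tendsto T atTop (𝓝 1))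
    (φ : Real.Angle) : ∃ᶠ t in atTop, (θ t : Real.Angle) = φ := by
  induction φ using Real.Angle.induction_on with
  | h x =>
    obtain ⟨t₀, ht₀⟩ := eventually_atTop.1
      (hT.eventually_const_lt (show (9 / 10 : ℝ) < 1 by norm_num))
    refine frequently_atTop.2 fun N => ?_
    set M := max N t₀
    obtain ⟨n, hn⟩ := exists_nat_ge ((x - θ M) / (2 * Real.pi))
    have hn' : x - n * (2 * Real.pi) ≤ θ M := by
      rw [div_le_iff₀ Real.two_pi_pos] at hn
      linarith
    obtain ⟨t, ht, hlt⟩ : ∃ t ≥ M, θ t < x - n * (2 * Real.pi) := by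
      by_contra! hcon
      refine false_of_deriv_ge_of_le (ε := 1 / 2) (t₀ := M) (B := -(x - n * (2 * Real.pi)))
        (by norm_num) (fun t _ => (h.deriv_θ t).neg) (fun t ht => ?_)
        fun t ht => neg_le_neg (hcon t ht)
      have h9 := ht₀ t ((le_max_right _ _).trans ht)
      have h1 := h.le_one t
      have hsc := abs_le.1 (abs_mul_le_one (Real.abs_sin_le_one (θ t)) (Real.abs_cos_le_one (θ t)))
      nlinarith
    obtain ⟨r, hr, hrx⟩ := intermediate_value_Icc' ht h.continuous_θ.continuousOn ⟨hlt.le, hn'⟩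
    refine ⟨r, (le_max_left _ _).trans hr.1, ?_⟩
    rw [hrx]
    simp

theorem omegaSet_subset_top (hT : Tendsto T atTop (𝓝 1)) : omegaSet (project T θ) ⊆ top := by
  intro p hp
  have h1 : MapClusterPt p.1 atTop T :=
    MapClusterPt.continuousAt_comp (f := Prod.fst) continuous_fst.continuousAt hp
  exact (mapClusterPt_iff_eq_of_tendsto hT).1 h1

theorem IsLift.omegaSet_eq_top (h : IsLift T θ) (hT : Tendsto T atTop (𝓝 1)) :
    omegaSet (project T θ) = top := by
  refine (omegaSet_subset_top hT).antisymm ?_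
  rintro ⟨x, φ⟩ hx
  obtain rfl : x = 1 := hx
  refine mapClusterPt_iff_frequently.2 fun s hs => ?_
  have hev : ∀ᶠ t in atTop, (T t, φ) ∈ s :=
    (hT.prodMk_nhds (tendsto_const_nhds (x := φ))).eventually hs
  refine ((h.frequently_angle_eq hT φ).and_eventually hev).mono fun t ht => ?_
  rw [project, ht.1]
  exact ht.2

theorem isLift_top : IsLift (fun _ => 1) fun t => -t where
  nonneg _ := zero_le_one
  le_one _ := le_rfl
  deriv_T t := by simpa using hasDerivAt_const t (1 : ℝ)
  deriv_θ t := by simpa using hasDerivAt_neg t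

theorem isPeriodicOrbit_top : IsPeriodicOrbit top := by
  refine ⟨_, isLift_top.isSolution, ?_, ?_, 2 * Real.pi, Real.two_pi_pos, fun t => ?_⟩
  · refine Subset.antisymm (range_subset_iff.2 fun _ => rfl) ?_
    rintro ⟨x, φ⟩ hx
    obtain rfl : x = 1 := hx
    induction φ using Real.Angle.induction_on with
    | h y => exact ⟨-y, by simp [project]⟩
  · refine ⟨(1, 0), rfl, (1, (Real.pi : Real.Angle)), rfl, fun h => ?_⟩
    exact Real.Angle.pi_ne_zero (congrArg Prod.snd h).symm
  · rw [project, project]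
    congr 1
    rw [Real.Angle.angle_eq_iff_two_pi_dvd_sub]
    exact ⟨-1, by push_cast; ring⟩

theorem field_top {p : Cyl} (hp : p ∈ top) : field p = (0, -1) := by
  have : p.1 = 1 := hp
  simp [field, this]

/-- On `T = 0` one has `(cos θ)' = 3 sin² θ cos θ`; the backward comparison is applied to the
time-reversed solution. -/
theorem IsLift.le_cos_of_bottom (h : IsLift T θ) (hT : ∀ t, T t = 0) {t₁ : ℝ}
    (hc : 0 ≤ Real.cos (θ t₁)) {t : ℝ} (ht : t₁ ≤ t) : Real.cos (θ t₁) ≤ Real.cos (θ t) := by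
  have h1 : ∀ t, T t < 1 := fun t => by rw [hT]; exact zero_lt_one
  have hcθ := h.continuous_θ
  have := le_of_deriv_le_neg_mul (f := fun t => Real.cos (θ (-t))) (t₁ := -t₁) (t := -t)
    (a := fun t => 3 * Real.sin (θ (-t)) ^ 2) (by fun_prop) (fun t => by positivity)
    (fun t => (h.hasDerivAt_cos h1 (-t)).comp t (hasDerivAt_neg t)) (fun t _ => ?_)
    (by simpa using hc) (by linarith)
  · simpa using this
  · rw [hT, odds]
    refine le_of_eq ?_
    ring

theorem IsLift.tendsto_dSPlus_of_bottom (h : IsLift T θ) (hT : ∀ t, T t = 0)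
    (hc : 0 < Real.cos (θ 0)) : Tendsto (project T θ) atTop (𝓝 dSPlus) := by
  have h1 : ∀ t, T t < 1 := fun t => by rw [hT]; exact zero_lt_one
  refine tendsto_dSPlus (by simp [project, hT]) ?_
  simp only [project, Real.Angle.cos_coe]
  have hge : ∀ t ≥ 0, Real.cos (θ 0) ≤ Real.cos (θ t) := fun t ht =>
    h.le_cos_of_bottom hT hc.le ht
  refine tendsto_order.2 ⟨fun a ha => ?_,
    fun a ha => .of_forall fun t => (Real.cos_le_one _).trans_lt ha⟩
  by_contra hcon
  have hle : ∀ t ≥ 0, Real.cos (θ t) ≤ a := by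
    intro t ht
    by_contra! hlt
    refine hcon ((eventually_ge_atTop t).mono fun s hs => hlt.trans_le ?_)
    exact h.le_cos_of_bottom hT (hc.le.trans (hge t ht)) hs
  have ha0 : 0 < a := hc.trans_le (hle 0 le_rfl)
  have hδ : 0 < 1 - a ^ 2 := by nlinarith
  refine false_of_deriv_ge_of_le (t₀ := 0) (B := 1) (ε := 3 * ((1 - a ^ 2) * Real.cos (θ 0)))
    (by positivity) (fun t _ => h.hasDerivAt_cos h1 t) (fun t ht => ?_)
    fun t _ => Real.cos_le_one _
  have hs : 1 - a ^ 2 ≤ Real.sin (θ t) ^ 2 := by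
    have := Real.sin_sq_add_cos_sq (θ t)
    have := hle t ht
    have := hc.le.trans (hge t ht)
    nlinarith
  have := mul_le_mul hs (hge t ht) hc.le (sq_nonneg _)
  rw [hT, odds]
  linarith

end ForwardLimits

/-! ### Fixed points, linearizations, stability of the sources. -/

section FixedPoints

theorem field_halfTurn (p : Cyl) : field (halfTurn p) = field p := by
  simp [field, halfTurn, Real.Angle.sin_add_pi]

theorem isFixedPoint_halfTurn {p : Cyl} (hp : IsFixedPoint p) : IsFixedPoint (halfTurn p) :=
  ⟨hp.1, by rw [field_halfTurn, hp.2]⟩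

theorem isFixedPoint_iff (p : Cyl) :
    IsFixedPoint p ↔ p = MPlus ∨ p = MMinus ∨ p = dSPlus ∨ p = dSMinus := by
  obtain ⟨x, φ⟩ := p
  constructor
  · rintro ⟨hp, hf⟩
    simp only [field, Real.Angle.sin_two_nsmul, Prod.mk_eq_zero, nsmul_eq_mul,
      Nat.cast_ofNat] at hf
    obtain ⟨e1, e2⟩ := hf
    have hx1 : x ≠ 1 := fun e => by norm_num [e] at e2
    have hx0 : x = 0 := by
      by_contra hx
      have hs : φ.sin = 0 := by
        have : 1 - x ≠ 0 := sub_ne_zero.2 hx1.symm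
        simpa [hx, this] using e1
      rw [hs] at e2
      exact hx (by linarith)
    subst hx0
    have hsc : φ.sin * φ.cos = 0 := by linarith
    simp only [MPlus, MMinus, dSPlus, dSMinus, Prod.mk.injEq, true_and]
    rcases mul_eq_zero.1 hsc with hs | hc
    · rcases Real.Angle.sin_eq_zero_iff.1 hs with h | h <;> simp [h]
    · rcases Real.Angle.cos_eq_zero_iff.1 hc with h | h <;> simp [h]
  · rintro (h | h | h | h) <;> rw [h]
    · exact ⟨by simp [closedState, MPlus], by simp [field, MPlus]⟩
    · rw [← halfTurn_MPlus]
      exact isFixedPoint_halfTurn ⟨by simp [closedState, MPlus], by simp [field, MPlus]⟩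
    · exact ⟨by simp [closedState, dSPlus], by simp [field, dSPlus]⟩
    · exact ⟨by simp [closedState, dSMinus], by simp [field, dSMinus]⟩

theorem isSolution_const {p : Cyl} (hp : IsFixedPoint p) : IsSolution fun _ => p := by
  obtain ⟨x, φ⟩ := p
  induction φ using Real.Angle.induction_on with
  | h y =>
    refine ⟨fun _ => hp.1, fun _ => x, fun _ => y, fun _ => rfl, fun t => ?_⟩
    simp only [hp.2]
    exact ⟨hasDerivAt_const t x, hasDerivAt_const t y⟩

/-- One computation serves all four fixed points. The matrix is triangular because `T'` carries the
factor `T`. -/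
theorem linearization_bottom (a : ℝ) :
    linearization (0, (a : Real.Angle)) =
      ((3 * Real.sin a ^ 2) • ContinuousLinearMap.fst ℝ ℝ ℝ).prod
        ((-1 + 3 * (Real.sin a * Real.cos a)) • ContinuousLinearMap.fst ℝ ℝ ℝ +
          (-3 * (Real.cos a ^ 2 - Real.sin a ^ 2)) • ContinuousLinearMap.snd ℝ ℝ ℝ) := by
  have e : (fun x : ℝ × ℝ => field (0 + x.1, (a : Real.Angle) + (x.2 : Real.Angle))) =
      fun x : ℝ × ℝ => (3 * x.1 * (1 - x.1) ^ 2 * Real.sin (a + x.2) ^ 2,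
        -x.1 - 3 * (1 - x.1) * (Real.sin (a + x.2) * Real.cos (a + x.2))) := by
    funext x
    rw [← Real.Angle.coe_add, zero_add, field_coe, liftField]
  refine HasFDerivAt.fderiv ?_
  simp only [e]
  have h1 : HasFDerivAt (fun x : ℝ × ℝ => x.1) (ContinuousLinearMap.fst ℝ ℝ ℝ) 0 := hasFDerivAt_fst
  have h2 : HasFDerivAt (fun x : ℝ × ℝ => a + x.2) (ContinuousLinearMap.snd ℝ ℝ ℝ) 0 :=
    hasFDerivAt_snd.const_add a
  have hk := h1.const_sub 1
  refine HasFDerivAt.congr_fderiv ((((h1.const_mul 3).mul (hk.pow 2)).mul (h2.sin.pow 2)).prodMk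
    (h1.neg.sub ((hk.const_mul 3).mul (h2.sin.mul h2.cos)))) ?_
  ext <;> simp <;> ring

theorem aroots_charpoly_of_triangular {f : (ℝ × ℝ) →ₗ[ℝ] (ℝ × ℝ)} {r s t : ℝ}
    (h1 : f (1, 0) = (r, t)) (h2 : f (0, 1) = (0, s)) :
    f.charpoly.aroots ℂ = {(r : ℂ), (s : ℂ)} := by
  have hm : LinearMap.toMatrix (Module.Basis.finTwoProd ℝ) (Module.Basis.finTwoProd ℝ) f =
      !![r, 0; t, s] := by
    ext i j
    fin_cases i <;> fin_cases j <;> simp [LinearMap.toMatrix_apply, h1, h2]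
  have hchar : f.charpoly = (Polynomial.X - Polynomial.C r) * (Polynomial.X - Polynomial.C s) := by
    rw [← LinearMap.charpoly_toMatrix f (Module.Basis.finTwoProd ℝ), hm, Matrix.charpoly_fin_two]
    simp only [Matrix.trace_fin_two_of, Matrix.det_fin_two_of, zero_mul, sub_zero, map_add,
      map_mul]
    ring
  rw [hchar, Polynomial.aroots_mul (mul_ne_zero (Polynomial.X_sub_C_ne_zero r)
    (Polynomial.X_sub_C_ne_zero s)), Polynomial.aroots_X_sub_C, Polynomial.aroots_X_sub_C]
  rfl

theorem linearization_halfTurn (p : Cyl) : linearization (halfTurn p) = linearization p := by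
  have e : (fun x : ℝ × ℝ => field ((halfTurn p).1 + x.1, (halfTurn p).2 + (x.2 : Real.Angle))) =
      fun x : ℝ × ℝ => field (p.1 + x.1, p.2 + (x.2 : Real.Angle)) := by
    funext x
    rw [← field_halfTurn (p.1 + x.1, p.2 + (x.2 : Real.Angle))]
    simp only [halfTurn, add_right_comm]
  rw [linearization, e, linearization]

theorem eigenvalues_MPlus : eigenvalues MPlus = {3, 3} := by
  rw [eigenvalues, MPlus, linearization_bottom,
    aroots_charpoly_of_triangular (r := 3) (s := 3) (t := -1) (by simp) (by simp)]
  simp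

theorem eigenvalues_M {p : Cyl} (hp : p = MPlus ∨ p = MMinus) : eigenvalues p = {3, 3} := by
  rcases hp with rfl | rfl
  · exact eigenvalues_MPlus
  · rw [← halfTurn_MPlus, eigenvalues, linearization_halfTurn]
    exact eigenvalues_MPlus

theorem isHyperbolic_M {p : Cyl} (hp : p = MPlus ∨ p = MMinus) : IsHyperbolic p := by
  refine ⟨(isFixedPoint_iff p).2 (hp.imp_right Or.inl), fun z hz => ?_⟩
  rw [eigenvalues_M hp] at hz
  have : z = 3 := by simpa using hz
  simp [this]

theorem linearization_dS {p : Cyl} (hp : p = dSPlus ∨ p = dSMinus) :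
    linearization p = (0 : (ℝ × ℝ) →L[ℝ] ℝ).prod (-ContinuousLinearMap.fst ℝ ℝ ℝ +
      (-3 : ℝ) • ContinuousLinearMap.snd ℝ ℝ ℝ) := by
  have h : linearization dSPlus = (0 : (ℝ × ℝ) →L[ℝ] ℝ).prod (-ContinuousLinearMap.fst ℝ ℝ ℝ +
      (-3 : ℝ) • ContinuousLinearMap.snd ℝ ℝ ℝ) := by
    rw [dSPlus, linearization_bottom]
    ext <;> simp
  rcases hp with rfl | rfl
  · exact h
  · rw [← halfTurn_dSPlus, linearization_halfTurn, h]

theorem eigenvalues_dS {p : Cyl} (hp : p = dSPlus ∨ p = dSMinus) : eigenvalues p = {-3, 0} := by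
  rw [eigenvalues, linearization_dS hp,
    aroots_charpoly_of_triangular (r := 0) (s := -3) (t := -1) (by simp) (by simp),
    Multiset.pair_comm]
  simp

theorem not_isHyperbolic_dS {p : Cyl} (hp : p = dSPlus ∨ p = dSMinus) : ¬ IsHyperbolic p :=
  fun h => h.2 0 (by simp [eigenvalues_dS hp]) rfl

/-- Stability comes from the barrier, not from the eigenvalues: backwards `T` does not grow and `b`
does not fall, while `b ≤ sin θ ≤ 1`. -/
theorem isSource_MPlus : IsSource MPlus := by
  refine ⟨(isFixedPoint_iff _).2 (Or.inl rfl), fun V hV => ?_⟩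
  have hbasis : (𝓝 MPlus).HasBasis (fun ε : ℝ × ℝ => 0 < ε.1 ∧ 0 < ε.2) fun ε =>
      Metric.ball 0 ε.1 ×ˢ (Real.Angle.sin ⁻¹' Metric.ball 1 ε.2) := by
    rw [MPlus, nhds_prod_eq, nhds_angle_pi_div_two]
    exact Metric.nhds_basis_ball.prod (Metric.nhds_basis_ball.comap _)
  obtain ⟨⟨ε, δ⟩, ⟨hε, hδ⟩, hV⟩ := hbasis.mem_iff.1 hV
  have hg : ContinuousAt (fun p : Cyl => p.2.sin - odds p.1 / 3) MPlus := by
    refine (Real.Angle.continuous_sin.comp continuous_snd).continuousAt.sub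
      (ContinuousAt.div_const ?_ 3)
    exact ContinuousAt.comp (f := Prod.fst) (g := odds)
      (continuousAt_odds (by simp [MPlus])) continuousAt_fst
  have hg1 : MPlus.2.sin - odds MPlus.1 / 3 = 1 := by simp [MPlus, odds]
  -- The bound `0` yields convergence and `1 - δ` keeps the sine in the prescribed ball; below, `1`
  -- in `min ε 1` excludes the circle `T = 1`.
  have ev1 : ∀ᶠ p in 𝓝 MPlus, max 0 (1 - δ) < p.2.sin - odds p.1 / 3 :=
    hg.eventually_const_lt ((max_lt zero_lt_one (sub_lt_self 1 hδ)).trans_eq hg1.symm)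
  have ev2 : ∀ᶠ p : Cyl in 𝓝 MPlus, p.1 < min ε 1 :=
    continuousAt_fst.eventually_lt_const (lt_min hε zero_lt_one)
  refine ⟨_, ev1.and ev2, fun c hc hU => ?_⟩
  obtain ⟨T, θ, h, rfl⟩ := isSolution_iff.1 hc
  obtain ⟨hb, hT⟩ := hU
  have h1 : ∀ t, T t < 1 := h.lt_one (lt_of_lt_of_le hT (min_le_right _ _))
  have hb' : max 0 (1 - δ) < barrier T θ 0 := by
    simpa only [project, Real.Angle.sin_coe, barrier] using hb
  have hb0 : 0 < barrier T θ 0 := (le_max_left _ _).trans_lt hb'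
  refine ⟨fun t ht => hV ⟨?_, ?_⟩, h.tendsto_MPlus_of_barrier h1 hb0⟩
  · have e1 : T t ≤ T 0 := h.monotone ht
    have e2 : T 0 < ε := lt_of_lt_of_le hT (min_le_left _ _)
    have e3 := h.nonneg t
    simp only [Metric.mem_ball, Real.dist_eq, project, sub_zero]
    exact abs_lt.2 ⟨by linarith, by linarith⟩
  · have e1 := (h.barrier_le h1 hb0.le ht).trans (h.barrier_le_sin h1 t)
    have e2 : 1 - δ < barrier T θ 0 := (le_max_right _ _).trans_lt hb'
    have e3 := Real.sin_le_one (θ t)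
    simp only [mem_preimage, Metric.mem_ball, Real.dist_eq, project, Real.Angle.sin_coe]
    exact abs_lt.2 ⟨by linarith, by linarith⟩

theorem isSource_halfTurn {p : Cyl} (hp : IsSource p) : IsSource (halfTurn p) := by
  refine ⟨isFixedPoint_halfTurn hp.1, fun V hV => ?_⟩
  obtain ⟨U, hU, h⟩ := hp.2 (halfTurn ⁻¹' V) (continuous_halfTurn.continuousAt hV)
  refine ⟨halfTurn ⁻¹' U, continuous_halfTurn.continuousAt (by rwa [halfTurn_halfTurn]),
    fun c hc h0 => ?_⟩
  obtain ⟨h1, h2⟩ := h _ (isSolution_halfTurn hc) h0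
  refine ⟨fun t ht => by simpa [halfTurn_halfTurn] using h1 t ht, ?_⟩
  rwa [← tendsto_halfTurn_iff, halfTurn_halfTurn]

end FixedPoints

/-! ### Orbits on `T = 0` and the stable sets of the de Sitter points. -/

section Bottom

theorem halfTurn_mem_bottom_iff {p : Cyl} : halfTurn p ∈ bottom ↔ p ∈ bottom := Iff.rfl

theorem tendsto_dSPlus_of_bottom {c : ℝ → Cyl} (hc : IsSolution c) (h0 : c 0 ∈ bottom)
    (hcos : 0 < (c 0).2.cos) : Tendsto c atTop (𝓝 dSPlus) := by
  obtain ⟨T, θ, h, rfl⟩ := isSolution_iff.1 hc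
  exact h.tendsto_dSPlus_of_bottom (h.eq_zero h0) (by simpa [project] using hcos)

theorem tendsto_dSMinus_of_bottom {c : ℝ → Cyl} (hc : IsSolution c) (h0 : c 0 ∈ bottom)
    (hcos : (c 0).2.cos < 0) : Tendsto c atTop (𝓝 dSMinus) := by
  have := tendsto_dSPlus_of_bottom (isSolution_halfTurn hc) (halfTurn_mem_bottom_iff.2 h0)
    (by simpa [halfTurn, Real.Angle.cos_add_pi] using hcos)
  rwa [← halfTurn_dSMinus, tendsto_halfTurn_iff] at this

theorem tendsto_MPlus_of_bottom {c : ℝ → Cyl} (hc : IsSolution c) (h0 : c 0 ∈ bottom)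
    (hsin : 0 < (c 0).2.sin) : Tendsto c atBot (𝓝 MPlus) := by
  obtain ⟨T, θ, h, rfl⟩ := isSolution_iff.1 hc
  have hT : T 0 = 0 := h0
  refine h.tendsto_MPlus_of_barrier (h.lt_one (t₀ := 0) (by rw [hT]; exact zero_lt_one))
    (t₁ := 0) ?_
  simpa [barrier, hT, odds, project] using hsin

theorem tendsto_MMinus_of_bottom {c : ℝ → Cyl} (hc : IsSolution c) (h0 : c 0 ∈ bottom)
    (hsin : (c 0).2.sin < 0) : Tendsto c atBot (𝓝 MMinus) := by
  have := tendsto_MPlus_of_bottom (isSolution_halfTurn hc) (halfTurn_mem_bottom_iff.2 h0)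
    (by simpa [halfTurn, Real.Angle.sin_add_pi] using hsin)
  rwa [← halfTurn_MMinus, tendsto_halfTurn_iff] at this

theorem omegaSet_eq_of_cos_eq_zero {c : ℝ → Cyl} (hc : IsSolution c) (h0 : c 0 ∈ bottom)
    (hcos : (c 0).2.cos = 0) : omegaSet c = {c 0} := by
  have hfix : IsFixedPoint (c 0) := by
    refine ⟨hc.1 0, ?_⟩
    have : (c 0).1 = 0 := h0
    simp [field, Real.Angle.sin_two_nsmul, this, hcos]
  have e : c = fun _ => c 0 := eq_of_isSolution hc (isSolution_const hfix) (t₀ := 0) rfl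
  refine omegaSet_eq_of_tendsto ?_
  rw [e]
  exact tendsto_const_nhds

/-- Off the bottom circle `T → 1`, so no accumulation point can have `T = 0`. -/
theorem bottom_of_omegaSet_eq_singleton {c : ℝ → Cyl} (hc : IsSolution c) {p : Cyl}
    (hp : p ∈ bottom) (h : omegaSet c = {p}) : c 0 ∈ bottom := by
  obtain ⟨T, θ, hl, rfl⟩ := isSolution_iff.1 hc
  by_contra h0
  have hpos : 0 < T 0 := lt_of_le_of_ne (hl.nonneg 0) (Ne.symm h0)
  have hmem : p ∈ omegaSet (project T θ) := by rw [h]; rfl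
  have h1 : p.1 = 1 := omegaSet_subset_top (hl.tendsto_one (hl.pos hpos)) hmem
  have h2 : p.1 = 0 := hp
  linarith

theorem omegaSet_eq_dSPlus_iff {c : ℝ → Cyl} (hc : IsSolution c) :
    omegaSet c = {dSPlus} ↔ c 0 ∈ bottom ∧ 0 < (c 0).2.cos := by
  refine ⟨fun h => ?_, fun h => omegaSet_eq_of_tendsto (tendsto_dSPlus_of_bottom hc h.1 h.2)⟩
  have h0 := bottom_of_omegaSet_eq_singleton hc (p := dSPlus) rfl h
  refine ⟨h0, ?_⟩
  rcases lt_trichotomy (c 0).2.cos 0 with hneg | hz | hpos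
  · rw [omegaSet_eq_of_tendsto (tendsto_dSMinus_of_bottom hc h0 hneg)] at h
    exact absurd (singleton_injective h).symm dSPlus_ne_dSMinus
  · rw [omegaSet_eq_of_cos_eq_zero hc h0 hz] at h
    rw [singleton_injective h] at hz
    simp [dSPlus] at hz
  · exact hpos

theorem omegaSet_eq_dSMinus_iff {c : ℝ → Cyl} (hc : IsSolution c) :
    omegaSet c = {dSMinus} ↔ c 0 ∈ bottom ∧ (c 0).2.cos < 0 := by
  refine ⟨fun h => ?_, fun h => omegaSet_eq_of_tendsto (tendsto_dSMinus_of_bottom hc h.1 h.2)⟩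
  have h0 := bottom_of_omegaSet_eq_singleton hc (p := dSMinus) rfl h
  refine ⟨h0, ?_⟩
  rcases lt_trichotomy (c 0).2.cos 0 with hneg | hz | hpos
  · exact hneg
  · rw [omegaSet_eq_of_cos_eq_zero hc h0 hz] at h
    rw [singleton_injective h] at hz
    simp [dSMinus] at hz
  · rw [omegaSet_eq_of_tendsto (tendsto_dSPlus_of_bottom hc h0 hpos)] at h
    exact absurd (singleton_injective h) dSPlus_ne_dSMinus

end Bottom

/-! ### Orbits in the interior and the attractor solutions. -/

section Interior

/-- A solution in the interior has a lift with `0 < T < 1`. -/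
theorem exists_lift_of_state {c : ℝ → Cyl} (hc : IsSolution c) (h0 : c 0 ∈ state) :
    ∃ T θ, IsLift T θ ∧ (∀ t, 0 < T t) ∧ (∀ t, T t < 1) ∧ c = project T θ := by
  obtain ⟨T, θ, h, rfl⟩ := isSolution_iff.1 hc
  exact ⟨T, θ, h, h.pos h0.1, h.lt_one h0.2, rfl⟩

theorem strictMono_of_state {c : ℝ → Cyl} (hc : IsSolution c) (h0 : c 0 ∈ state) :
    StrictMono fun t => (c t).1 := by
  obtain ⟨T, θ, h, hpos, hlt, rfl⟩ := exists_lift_of_state hc h0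
  exact h.strictMono hpos hlt

theorem omegaSet_eq_top_of_state {c : ℝ → Cyl} (hc : IsSolution c) (h0 : c 0 ∈ state) :
    omegaSet c = top := by
  obtain ⟨T, θ, h, hpos, -, rfl⟩ := exists_lift_of_state hc h0
  exact h.omegaSet_eq_top (h.tendsto_one hpos)

theorem decel_mem_Icc (p : Cyl) : -1 ≤ decel p ∧ decel p ≤ 2 := by
  have := Real.Angle.cos_sq_add_sin_sq p.2
  rw [decel]
  constructor <;> nlinarith [sq_nonneg p.2.sin, sq_nonneg p.2.cos]

theorem frequently_decel_eq {c : ℝ → Cyl} (hc : IsSolution c) (h0 : c 0 ∈ state)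
    (φ : Real.Angle) : ∃ᶠ t in atTop, decel (c t) = -1 + 3 * φ.sin ^ 2 := by
  obtain ⟨T, θ, h, hpos, -, rfl⟩ := exists_lift_of_state hc h0
  refine (h.frequently_angle_eq (h.tendsto_one hpos) φ).mono fun t ht => ?_
  rw [decel, project, ht]

theorem decel_oscillates {c : ℝ → Cyl} (hc : IsSolution c) (h0 : c 0 ∈ state) :
    (∃ᶠ t in atTop, decel (c t) = -1) ∧ (∃ᶠ t in atTop, decel (c t) = 2) ∧
      ¬ ∃ l : ℝ, Tendsto (fun t => decel (c t)) atTop (𝓝 l) := by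
  have e1 : ∃ᶠ t in atTop, decel (c t) = -1 := by
    simpa using frequently_decel_eq hc h0 0
  have e2 : ∃ᶠ t in atTop, decel (c t) = 2 := by
    have := frequently_decel_eq hc h0 ((Real.pi / 2 : ℝ) : Real.Angle)
    norm_num at this
    exact this
  refine ⟨e1, e2, ?_⟩
  rintro ⟨l, hl⟩
  have h1 := tendsto_nhds_unique_of_frequently_eq hl tendsto_const_nhds e1
  have h2 := tendsto_nhds_unique_of_frequently_eq hl tendsto_const_nhds e2
  linarith

theorem range_subset_state {c : ℝ → Cyl} (hc : IsSolution c) (h0 : c 0 ∈ state) :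
    range c ⊆ state :=
  range_subset_iff.2 fun t => (isSolution_invariant hc t).1.1 h0

theorem range_halfTurn (c : ℝ → Cyl) : range (fun t => halfTurn (c t)) = halfTurn '' range c :=
  range_comp halfTurn c

theorem range_eq_of_tendsto_dSPlus_of_state {c d : ℝ → Cyl} (hc : IsSolution c) (hd : IsSolution d)
    (hc0 : c 0 ∈ state) (hd0 : d 0 ∈ state) (hcl : Tendsto c atBot (𝓝 dSPlus))
    (hdl : Tendsto d atBot (𝓝 dSPlus)) : range c = range d := by
  obtain ⟨T, θ, h, hpos, hlt, rfl⟩ := exists_lift_of_state hc hc0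
  obtain ⟨T', θ', h', hpos', hlt', rfl⟩ := exists_lift_of_state hd hd0
  exact range_eq_of_tendsto_dSPlus h hpos hlt hcl h' hpos' hlt' hdl

theorem tendsto_atBot_of_state {c : ℝ → Cyl} (hc : IsSolution c) (h0 : c 0 ∈ state) :
    Tendsto c atBot (𝓝 MPlus) ∨ Tendsto c atBot (𝓝 MMinus) ∨ Tendsto c atBot (𝓝 dSPlus) ∨
      Tendsto c atBot (𝓝 dSMinus) := by
  obtain ⟨T, θ, h, -, hlt, rfl⟩ := exists_lift_of_state hc h0
  exact (h.tendsto_M_or_abs_sin_le hlt).imp_right fun h' =>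
    h'.imp_right (h.tendsto_dS_of_abs_sin_le hlt)

theorem exists_attractors :
    ∃ Aplus Aminus : Set Cyl,
      (∀ O, OriginatesFrom dSPlus O ↔ O = Aplus) ∧
      (∀ O, OriginatesFrom dSMinus O ↔ O = Aminus) ∧
      Aminus = halfTurn '' Aplus ∧
      ∀ c, IsSolution c → c 0 ∈ state → range c ≠ Aplus → range c ≠ Aminus →
        alphaSet c = {MPlus} ∨ alphaSet c = {MMinus} := by
  obtain ⟨T, θ, h, hpos, hlt, hlim⟩ := exists_lift_tendsto_dSPlus
  have ha := h.isSolution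
  set a := project T θ
  have ha0 : a 0 ∈ state := ⟨hpos 0, hlt 0⟩
  have hplus : ∀ c, IsSolution c → c 0 ∈ state → Tendsto c atBot (𝓝 dSPlus) →
      range c = range a := fun c hc h0 hcl =>
    range_eq_of_tendsto_dSPlus_of_state hc ha h0 ha0 hcl hlim
  have hminus : ∀ c, IsSolution c → c 0 ∈ state → Tendsto c atBot (𝓝 dSMinus) →
      range c = halfTurn '' range a := by
    intro c hc h0 hcl
    -- Reading `dSPlus` as the half-turn of `dSMinus` lets uniqueness at one point, applied to the
    -- turned solution, give uniqueness at the other.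
    rw [← halfTurn_dSMinus] at hplus
    rw [← hplus _ (isSolution_halfTurn hc) h0 (tendsto_halfTurn_iff.2 hcl), range_halfTurn,
      image_image]
    simp only [halfTurn_halfTurn, image_id']
  refine ⟨range a, halfTurn '' range a, fun O => ⟨?_, ?_⟩, fun O => ⟨?_, ?_⟩, rfl, ?_⟩
  · rintro ⟨hO, c, hc, rfl, hα⟩
    exact hplus c hc (hO ⟨0, rfl⟩) (tendsto_of_alphaSet_eq hc hα)
  · rintro rfl
    exact ⟨range_subset_state ha ha0, a, ha, rfl, alphaSet_eq_of_tendsto hlim⟩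
  · rintro ⟨hO, c, hc, rfl, hα⟩
    exact hminus c hc (hO ⟨0, rfl⟩) (tendsto_of_alphaSet_eq hc hα)
  · rintro rfl
    have hb := isSolution_halfTurn ha
    rw [← range_halfTurn]
    refine ⟨range_subset_state hb ha0, _, hb, rfl, alphaSet_eq_of_tendsto ?_⟩
    rwa [← halfTurn_dSPlus, tendsto_halfTurn_iff]
  · intro c hc h0 h1 h2
    rcases tendsto_atBot_of_state hc h0 with hM | hM | hd | hd
    · exact Or.inl (alphaSet_eq_of_tendsto hM)
    · exact Or.inr (alphaSet_eq_of_tendsto hM)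
    · exact absurd (hplus c hc h0 hd) h1
    · exact absurd (hminus c hc h0 hd) h2

end Interior

end ScalarFieldFLRW

theorem mainTheorem1 :
    -- through every point of the closed cylinder there is exactly one solution, defined for all
    -- times, and the interior and the two boundary circles are invariant
    (∀ p ∈ closedState, ∃! c : ℝ → Cyl, IsSolution c ∧ c 0 = p) ∧
    (∀ c, IsSolution c → ∀ τ, (c 0 ∈ state ↔ c τ ∈ state) ∧
      (c 0 ∈ bottom ↔ c τ ∈ bottom) ∧ (c 0 ∈ top ↔ c τ ∈ top)) ∧
    -- the discrete symmetry, which exchanges the two points of each pair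
    (∀ c, IsSolution c → IsSolution (fun τ => halfTurn (c τ))) ∧
    halfTurn MPlus = MMinus ∧ halfTurn dSPlus = dSMinus ∧
    -- T is strictly increasing along every orbit in the interior
    (∀ c, IsSolution c → c 0 ∈ state → StrictMono (fun τ => (c τ).1)) ∧
    -- the fixed points
    (∀ p, IsFixedPoint p ↔ p = MPlus ∨ p = MMinus ∨ p = dSPlus ∨ p = dSMinus) ∧
    -- the hyperbolic sources
    (∀ p, p = MPlus ∨ p = MMinus →
      IsHyperbolic p ∧ eigenvalues p = {3, 3} ∧ IsSource p) ∧
    -- the de Sitter points are not hyperbolic; the eigenvalue -3 belongs to the direction of T = 0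
    (∀ p, p = dSPlus ∨ p = dSMinus →
      ¬ IsHyperbolic p ∧ eigenvalues p = {-3, 0} ∧ linearization p (0, 1) = (0, -3)) ∧
    -- their stable sets are open arcs of T = 0
    (∀ c, IsSolution c →
      (omegaSet c = {dSPlus} ↔ c 0 ∈ bottom ∧ 0 < (c 0).2.cos) ∧
      (omegaSet c = {dSMinus} ↔ c 0 ∈ bottom ∧ (c 0).2.cos < 0)) ∧
    -- no orbit in T = 0 other than a de Sitter point itself originates from a de Sitter point
    (∀ c, IsSolution c → c 0 ∈ bottom →
      (0 < (c 0).2.sin → alphaSet c = {MPlus}) ∧ ((c 0).2.sin < 0 → alphaSet c = {MMinus})) ∧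
    -- exactly one orbit leaves each de Sitter point into the interior, and all other orbits in the
    -- interior originate from the sources
    (∃ Aplus Aminus : Set Cyl,
      (∀ O, OriginatesFrom dSPlus O ↔ O = Aplus) ∧
      (∀ O, OriginatesFrom dSMinus O ↔ O = Aminus) ∧
      Aminus = halfTurn '' Aplus ∧
      ∀ c, IsSolution c → c 0 ∈ state → range c ≠ Aplus → range c ≠ Aminus →
        alphaSet c = {MPlus} ∨ alphaSet c = {MMinus}) ∧
    -- the circle T = 1 is a periodic orbit and the ω-limit set of every orbit in the interior
    IsPeriodicOrbit top ∧
    (∀ p ∈ top, field p = (0, -1)) ∧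
    (∀ c, IsSolution c → c 0 ∈ state → omegaSet c = top) ∧
    -- q keeps oscillating between -1 and 2 and has no limit
    (∀ c, IsSolution c → c 0 ∈ state →
      (∀ τ, -1 ≤ decel (c τ) ∧ decel (c τ) ≤ 2) ∧
      (∃ᶠ τ in atTop, decel (c τ) = -1) ∧ (∃ᶠ τ in atTop, decel (c τ) = 2) ∧
      ¬ ∃ l : ℝ, Tendsto (fun τ => decel (c τ)) atTop (𝓝 l)) := by
  refine ⟨fun p hp => existsUnique_isSolution hp, fun c hc t => isSolution_invariant hc t,
    fun c hc => isSolution_halfTurn hc, halfTurn_MPlus, halfTurn_dSPlus,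
    fun c hc h0 => strictMono_of_state hc h0, isFixedPoint_iff,
    fun p hp => ⟨isHyperbolic_M hp, eigenvalues_M hp, ?_⟩,
    fun p hp => ⟨not_isHyperbolic_dS hp, eigenvalues_dS hp, by simp [linearization_dS hp]⟩,
    fun c hc => ⟨omegaSet_eq_dSPlus_iff hc, omegaSet_eq_dSMinus_iff hc⟩,
    fun c hc h0 => ⟨fun hs => alphaSet_eq_of_tendsto (tendsto_MPlus_of_bottom hc h0 hs),
      fun hs => alphaSet_eq_of_tendsto (tendsto_MMinus_of_bottom hc h0 hs)⟩,
    exists_attractors, isPeriodicOrbit_top, fun p hp => field_top hp,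
    fun c hc h0 => omegaSet_eq_top_of_state hc h0,
    fun c hc h0 => ⟨fun t => decel_mem_Icc (c t), decel_oscillates hc h0⟩⟩
  rcases hp with rfl | rfl
  · exact isSource_MPlus
  · exact halfTurn_MPlus ▸ isSource_halfTurn isSource_MPlus
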